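/- **Setting.** Consider one of two supervised tasks with hyperparameter $\theta\in\Theta$ and local loss $v$: * quantile regression (QR): $\Theta=[0,1]$, $v(\theta,y,t)=\max\big(\theta(y-t),(\theta-1)(y-t)\big)$, and $|Y|\le B$ almost surely; * cost-sensitive classification (CSC): $\Theta=[-1,1]$, $v(\theta,y,t)=\big|\tfrac{\theta+1}{2}-\mathbf 1_{\{-1\}}(y)\big|\max(1-yt,0)$, and $Y\in\{-1,1\}$ almost surely. Let $(X,Y)$ have law $P$ on $\mathcal X\times\mathbb R$, where $\mathcal X$ is a measurable space. Let $k_{\mathcal X}$ be a jointly measurable real kernel on $\mathcal X$ with $k_{\mathcal X}(x,x)\le\kappa_{\mathcal X}^2$ for all $x$, and let $k_\Theta$ be a real kernel on $\Theta$, of class $C^1$ on $\Theta\times\Theta$ (so that its partial derivatives are bounded), with $k_\Theta(\theta,\theta)\le\kappa_\Theta^2$ for all $\theta$. Let $\mathcal H_{k_\Theta}$ be the RKHS of $k_\Theta$ and $\mathcal H_K$ the vector-valued RKHS of functions $\mathcal X\to\mathcal H_{k_\Theta}$ with kernel $K(x,z)=k_{\mathcal X}(x,z)\,I_{\mathcal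 H_{k_\Theta}}$. Let $\mu$ be a probability measure on $\Theta$ with distribution function $F$, and $F^{-1}(u)=\inf\{t\in\Theta: u\le F(t)\}$. Let $u_0,u_1,\dots$ be the one-dimensional Sobol sequence (if $j=\sum_i b_i2^i$ in binary, then $u_j=\sum_i b_i2^{-i-1}$), and $\theta_j=F^{-1}(u_j)$; for $\mu$ uniform on $[0,1]$ this is $\theta_j=u_j$. For $S=((x_i,y_i))_{i=1}^n$ and $h\in\mathcal H_K$ put $$R(h)=\mathbb E_{X,Y}\Big[\int_\Theta v\big(\theta,Y,h(X)(\theta)\big)\,d\mu(\theta)\Big],\qquad \widetilde R_S(h)=\frac1n\sum_{i=1}^n\frac1m\sum_{j=0}^{m-1}v\big(\theta_j,y_i,h(x_i)(\theta_j)\big).$$ **Proposition (Generalization).** For all $\lambda>0$, $n$, $m$ and $S$ the problem $$\min_{h\in\mathcal H_K}\ \widetilde R_S(h)+\tfrac{\lambda}{2}\|h\|_{\mathcal H_K}^2$$ has exactly one solution $h^*=h^*_S$. If $S\sim P^{\otimes n}$, then $$R(h^*)\le\widetilde R_S(h^*)+O_{P}\Big(\frac1{\sqrt{\lambda n}}\Big)+O\Big(\frac{\log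 m}{\sqrt\lambda\, m}\Big),$$ in the following sense. For all $\kappa_{\mathcal X},\kappa_\Theta,B,D,\Lambda$ there are a constant $C_2$ and constants $C_1(\delta)$, $\delta>0$, depending on nothing else but the task, such that the inequality $$R(h^*)\le\widetilde R_S(h^*)+\frac{C_1(\delta)}{\sqrt{\lambda n}}+C_2\frac{\log m}{\sqrt\lambda\,m}\qquad(*)$$ fails with (outer) probability at most $\delta$ in each of the following cases: 1. $\mu$ is uniform on $\Theta$, $0<\lambda\le\Lambda$, $n\ge1$, $\delta>0$ and $m\ge M$, where $M$ depends on $P$, the kernels and $\lambda$, but not on $n$ or $\delta$; 2. $\mu$ is any probability measure on $\Theta$, $0<\lambda\le\Lambda$, $n\ge1$, $m\ge2$, $\delta>0$ are arbitrary, and in addition $\theta\mapsto k_\Theta(\theta,\cdot)\in\mathcal H_{k_\Theta}$ is $D$-Lipschitz, i.e. $k_\Theta(s,s)+k_\Theta(t,t)-2k_\Theta(s,t)\le D^2(s-t)^2$ for all $s,t\in\Theta$ (for example $k_\Theta$ of class $C^2$ with $|\partial_1\partial_2k_\Theta|\le D^2$). -/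

import Mathlib

open MeasureTheory

noncomputable section

namespace InfiniteTask

/-- The two supervised parametrized tasks: quantile regression and cost-sensitive
classification. -/
inductive Task
  | quantileRegression
  | costSensitive

namespace Task

/-- Left end point of the hyperparameter interval. -/
def lo : Task → ℝ
  | quantileRegression => 0
  | costSensitive => -1

/-- Right end point of the hyperparameter interval. -/
def hi : Task → ℝ
  | quantileRegression => 1
  | costSensitive => 1

theorem lo_le_hi (τ : Task) : τ.lo ≤ τ.hi := by
  cases τ <;> norm_num [lo, hi]

/-- The hyperparameter space: `[0, 1]` for quantile regression, `[-1, 1]` for cost-sensitive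
classification. -/
abbrev Hyper (τ : Task) : Type := Set.Icc τ.lo τ.hi

/-- The local loss `v(θ, y, t)`: the pinball loss, respectively the cost-sensitive hinge loss. -/
def loss : Task → ℝ → ℝ → ℝ → ℝ
  | quantileRegression, θ, y, t => max (θ * (y - t)) ((θ - 1) * (y - t))
  | costSensitive, θ, y, t =>
      |(θ + 1) / 2 - Set.indicator {(-1 : ℝ)} (fun _ => 1) y| * max (1 - y * t) 0

/-- The admissible outputs: `[-B, B]` for quantile regression, `{-1, 1}` for cost-sensitive
classification. -/
def outputs (B : ℝ) : Task → Set ℝ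
  | quantileRegression => Set.Icc (-B) B
  | costSensitive => {-1, 1}

/-- The uniform probability measure on the hyperparameter interval. -/
def uniform (τ : Task) : Measure τ.Hyper :=
  (ENNReal.ofReal (τ.hi - τ.lo))⁻¹ • Measure.comap (Subtype.val : τ.Hyper → ℝ) volume

end Task

/-- The one-dimensional Sobol sequence (the base `2` radical inverse): the binary digits of `j`
are reflected at the binary point. -/
def sobol (j : ℕ) : ℝ :=
  ∑ i ∈ Finset.range j.size, if j.testBit i then (1 / 2 : ℝ) ^ (i + 1) else 0

/-- The generalized inverse `F⁻¹(u) = inf {t | u ≤ F(t)}`, for `0 ≤ u ≤ 1`, of the distribution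
function `F` of `μ`. For such `u` the infimum lies in the hyperparameter interval, so that the
projection onto the interval only serves to give the value its type. -/
def quantile (τ : Task) (μ : Measure τ.Hyper) (u : ℝ) : τ.Hyper :=
  Set.projIcc τ.lo τ.hi τ.lo_le_hi
    (sInf {t : ℝ | τ.lo ≤ t ∧ u ≤ μ.real {s : τ.Hyper | (s : ℝ) ≤ t}})

/-- The quasi-Monte Carlo nodes for `μ`: the Sobol points transported by `F⁻¹`. -/
def node (τ : Task) (μ : Measure τ.Hyper) (j : ℕ) : τ.Hyper :=
  quantile τ μ (sobol j)

section Risk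

variable {𝒳 HΘ H : Type*} (τ : Task)
  [NormedAddCommGroup HΘ] [InnerProductSpace ℝ HΘ] [RKHS ℝ HΘ τ.Hyper ℝ]
  [NormedAddCommGroup H] [InnerProductSpace ℝ H] [RKHS ℝ H 𝒳 HΘ]

/-- The integrated loss `V(y, h(x)) = ∫ v(θ, y, h(x)(θ)) dμ(θ)`. -/
def integratedLoss (μ : Measure τ.Hyper) (y : ℝ) (f : HΘ) : ℝ :=
  ∫ θ : τ.Hyper, τ.loss θ y (f θ) ∂μ

/-- The sampled loss, with `m` quasi-Monte Carlo nodes. -/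
def sampledLoss (μ : Measure τ.Hyper) (m : ℕ) (y : ℝ) (f : HΘ) : ℝ :=
  (1 / m : ℝ) * ∑ j ∈ Finset.range m, τ.loss (node τ μ j) y (f (node τ μ j))

/-- The true risk `R(h)`. -/
def risk [MeasurableSpace 𝒳] (μ : Measure τ.Hyper) (P : Measure (𝒳 × ℝ)) (h : H) : ℝ :=
  ∫ z : 𝒳 × ℝ, integratedLoss τ μ z.2 (h z.1) ∂P

/-- The sampled empirical risk of `h` on the training set `S`. -/
def sampledEmpiricalRisk (μ : Measure τ.Hyper) (m : ℕ) {n : ℕ} (S : Fin n → 𝒳 × ℝ) (h : H) : ℝ :=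
  (1 / n : ℝ) * ∑ i : Fin n, sampledLoss τ μ m (S i).2 (h (S i).1)

/-- `h` minimizes the ridge-regularized sampled empirical risk over the hypothesis space `H`. -/
def IsSolution (μ : Measure τ.Hyper) (lam : ℝ) (m : ℕ) {n : ℕ} (S : Fin n → 𝒳 × ℝ) (h : H) :
    Prop :=
  ∀ g : H, sampledEmpiricalRisk τ μ m S h + lam / 2 * ‖h‖ ^ 2 ≤
    sampledEmpiricalRisk τ μ m S g + lam / 2 * ‖g‖ ^ 2

end Risk

end InfiniteTask

end

/-!
The proof passes from the risk to the sampled empirical risk through the sampled risk, in which only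
the `μ`-integral has been replaced by the quasi-Monte Carlo mean.

The minimizer `h` lies in a ball whose radius is of order `1 / √λ`. For each single node `θ_j`,
symmetrization and contraction bound the expected uniform deviation over that ball; since the
sampled risks are means over the nodes, the bound passes to them, and Markov's inequality gives the
`1 / √(λ n)` term.

For the quadrature error, split `{0, …, m - 1}` into the dyadic blocks given by the binary digits of
`m`. The Sobol points of a block form a shifted dyadic grid, so the error is at most `1 / m` times
the sum, over the `O(log m)` digits, of the oscillations of the grid sums of the integrand in the
shift. If the integrand is Lipschitz in `θ`, each oscillation is bounded by monotonicity of the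
quantile function. If `kΘ` is only `C¹`, the Lipschitz constant of `h(x)` grows faster than
`1 / √λ`. However, perturbing the minimizer in the direction `K(·, x)w` shows
`|⟨h(x), w⟩| ≤ (κX² / λ) sup |w|`, so that `h(x)` inherits the modulus of smoothness of the
kernel: on fine dyadic cells the integrand is nearly the sum of an affine function and the positive
part of one, so that the oscillation of the grid sums is controlled by the size of the integrand.
The finitely many coarse scales are absorbed by `log m`.
-/

noncomputable section

namespace InfiniteTask

section VanDerCorput

theorem sum_range_mul {M : Type*} [AddCommMonoid M] (f : ℕ → M) (K J : ℕ) :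
    ∑ l ∈ Finset.range (K * J), f l =
      ∑ i ∈ Finset.range K, ∑ j ∈ Finset.range J, f (i * J + j) := by
  induction K with
  | zero => simp
  | succ K ih => rw [Nat.succ_mul, Finset.sum_range_add, ih, Finset.sum_range_succ]

theorem sobol_eq_sum_range {j N : ℕ} (h : j < 2 ^ N) :
    sobol j = ∑ i ∈ Finset.range N, if j.testBit i then (1 / 2 : ℝ) ^ (i + 1) else 0 := by
  refine Finset.sum_subset (by simpa using Nat.size_le.2 h) fun i _ hi => ?_
  have hij : j < 2 ^ i := Nat.size_le.1 (by simpa using hi)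
  simp [Nat.testBit_lt_two_pow hij]

theorem sobol_bit (b : Bool) (j : ℕ) : sobol (Nat.bit b j) = (b.toNat + sobol j) / 2 := by
  have hj : j < 2 ^ j := Nat.lt_two_pow_self
  have hbit : Nat.bit b j < 2 ^ (j + 1) := by
    rw [Nat.bit_val, pow_succ]
    have := Bool.toNat_le b
    omega
  rw [sobol_eq_sum_range hj, sobol_eq_sum_range hbit, Finset.sum_range_succ', add_comm, add_div,
    Finset.sum_div]
  congr 1
  · cases b <;> simp
  · refine Finset.sum_congr rfl fun i _ => ?_
    rw [Nat.testBit_bit_succ, pow_succ _ (i + 1)]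
    split_ifs <;> ring

theorem sobol_mem_Icc (j : ℕ) : sobol j ∈ Set.Icc (0 : ℝ) 1 := by
  induction j using Nat.binaryRec with
  | zero => simp [sobol]
  | bit b j ih =>
    rw [sobol_bit]
    cases b <;> simp only [Bool.toNat_false, Bool.toNat_true, Nat.cast_zero, Nat.cast_one] <;>
      constructor <;> linarith [ih.1, ih.2]

variable {E : Type*} [NormedAddCommGroup E]

theorem sum_range_sobol_two_mul (G : ℝ → E) (m : ℕ) :
    ∑ j ∈ Finset.range (2 * m), G (sobol j) =
      ∑ j ∈ Finset.range m, (G (sobol j / 2) + G ((1 + sobol j) / 2)) := by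
  rw [mul_comm, sum_range_mul]
  refine Finset.sum_congr rfl fun j _ => ?_
  have hbit (b : Bool) : j * 2 + b.toNat = Nat.bit b j := by rw [Nat.bit_val, mul_comm]
  have h0 := congrArg sobol (hbit false)
  have h1 := congrArg sobol (hbit true)
  rw [sobol_bit] at h0 h1
  simp_all [Finset.sum_range_succ]

/-- The sum of `G` over the `2 ^ k` points of the grid of mesh `2⁻ᵏ` with relative offset `x`. The
first `2 ^ k` Sobol points are such a grid, and any other dyadic block of `2 ^ k` consecutive ones
is the same grid with another offset. -/
def gridSum (k : ℕ) (G : ℝ → E) (x : ℝ) : E :=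
  ∑ l ∈ Finset.range (2 ^ k), G ((l + x) / 2 ^ k)

theorem gridSum_zero (G : ℝ → E) (x : ℝ) : gridSum 0 G x = G x := by simp [gridSum]

theorem gridSum_add (k r : ℕ) (G : ℝ → E) (x : ℝ) :
    gridSum (k + r) G x =
      ∑ i ∈ Finset.range (2 ^ k), gridSum r (fun u => G ((i + u) / 2 ^ k)) x := by
  unfold gridSum
  rw [pow_add, sum_range_mul]
  refine Finset.sum_congr rfl fun i _ => Finset.sum_congr rfl fun j _ => congrArg G ?_
  push_cast
  rw [pow_add]
  field_simp
  ring

theorem gridSum_succ (k : ℕ) (G : ℝ → E) (x : ℝ) :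
    gridSum (k + 1) G x = gridSum k (fun u => G (u / 2) + G ((1 + u) / 2)) x := by
  rw [add_comm k 1, gridSum_add, pow_one, Finset.sum_range_succ, Finset.sum_range_one]
  simp [gridSum, Finset.sum_add_distrib]

theorem grid_point_mem_Icc {k l : ℕ} (hl : l < 2 ^ k) {x : ℝ} (hx : x ∈ Set.Icc (0 : ℝ) 1) :
    (l + x) / 2 ^ k ∈ Set.Icc (0 : ℝ) 1 := by
  have hl' : (l : ℝ) + 1 ≤ 2 ^ k := by exact_mod_cast hl
  have hx0 := hx.1
  refine ⟨by positivity, ?_⟩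
  rw [div_le_one (by positivity)]
  linarith [hx.2]

theorem norm_gridSum_sub_le_of_monotoneOn {G : ℝ → E} {Q : ℝ → ℝ} {L : ℝ} (hL : 0 ≤ L)
    (hQ : MonotoneOn Q (Set.Icc 0 1))
    (hG : ∀ u ∈ Set.Icc (0 : ℝ) 1, ∀ u' ∈ Set.Icc (0 : ℝ) 1, ‖G u - G u'‖ ≤ L * |Q u - Q u'|)
    (k : ℕ) {x x' : ℝ} (hx : x ∈ Set.Icc (0 : ℝ) 1) (hx' : x' ∈ Set.Icc (0 : ℝ) 1) :
    ‖gridSum k G x - gridSum k G x'‖ ≤ L * (Q 1 - Q 0) := by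
  have hcell : ∀ l ∈ Finset.range (2 ^ k), ‖G ((l + x) / 2 ^ k) - G ((l + x') / 2 ^ k)‖ ≤
      L * (Q (((l + 1 : ℕ) : ℝ) / 2 ^ k) - Q ((l : ℝ) / 2 ^ k)) := fun l hl => by
    have hmem {y : ℝ} (hy : y ∈ Set.Icc (0 : ℝ) 1) : (l + y) / 2 ^ k ∈ Set.Icc (0 : ℝ) 1 :=
      grid_point_mem_Icc (Finset.mem_range.1 hl) hy
    have hleft : (l : ℝ) / 2 ^ k ∈ Set.Icc (0 : ℝ) 1 := by simpa using hmem (y := 0) (by simp)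
    have hright : (l + 1 : ℝ) / 2 ^ k ∈ Set.Icc (0 : ℝ) 1 := hmem (by simp)
    have hQcell {y : ℝ} (hy : y ∈ Set.Icc (0 : ℝ) 1) :
        Q ((l + y) / 2 ^ k) ∈ Set.Icc (Q (l / 2 ^ k)) (Q ((l + 1) / 2 ^ k)) :=
      ⟨hQ hleft (hmem hy) (by gcongr; linarith [hy.1]),
        hQ (hmem hy) hright (by gcongr; exact hy.2)⟩
    push_cast
    exact (hG _ (hmem hx) _ (hmem hx')).trans
      (mul_le_mul_of_nonneg_left (Real.dist_le_of_mem_Icc (hQcell hx) (hQcell hx')) hL)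
  calc ‖gridSum k G x - gridSum k G x'‖
      ≤ ∑ l ∈ Finset.range (2 ^ k), ‖G ((l + x) / 2 ^ k) - G ((l + x') / 2 ^ k)‖ := by
        rw [gridSum, gridSum, ← Finset.sum_sub_distrib]
        exact norm_sum_le _ _
    _ ≤ L * ∑ l ∈ Finset.range (2 ^ k), (Q (((l + 1 : ℕ) : ℝ) / 2 ^ k) - Q ((l : ℝ) / 2 ^ k)) := by
        rw [Finset.mul_sum]
        exact Finset.sum_le_sum hcell
    _ = L * (Q 1 - Q 0) := by
        rw [Finset.sum_range_sub (fun l : ℕ => Q ((l : ℝ) / 2 ^ k))]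
        simp

theorem intervalIntegrable_comp_half {G : ℝ → E} (hG : IntervalIntegrable G volume 0 1) :
    IntervalIntegrable (fun u => G (u / 2)) volume 0 1 ∧
      IntervalIntegrable (fun u => G ((1 + u) / 2)) volume 0 1 := by
  have hsub {a b : ℝ} (ha : a ∈ Set.Icc (0 : ℝ) 1) (hb : b ∈ Set.Icc (0 : ℝ) 1) :
      IntervalIntegrable (fun u => G (u / 2)) volume (2 * a) (2 * b) := by
    have := (hG.mono_set (c := a) (d := b) (Set.uIcc_subset_uIcc (by simpa using ha)
      (by simpa using hb))).comp_mul_right (c := (1 / 2 : ℝ))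
    simpa [div_eq_mul_inv, mul_comm] using this
  constructor
  · simpa using hsub (a := 0) (b := 1 / 2) (by norm_num) (by norm_num)
  · have := (hsub (a := 1 / 2) (b := 1) (by norm_num) (by norm_num)).comp_add_left 1
    norm_num at this
    exact this

variable [NormedSpace ℝ E]

theorem intervalIntegral_comp_half_add {G : ℝ → E} (hG : IntervalIntegrable G volume 0 1) :
    ∫ u in (0 : ℝ)..1, (G (u / 2) + G ((1 + u) / 2)) = (2 : ℝ) • ∫ u in (0 : ℝ)..1, G u := by
  obtain ⟨hleft, hright⟩ := intervalIntegrable_comp_half hG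
  have hshift := intervalIntegral.integral_comp_add_left (a := 0) (b := 1) (fun u => G (u / 2)) 1
  have hsub {a b : ℝ} (ha : a ∈ Set.Icc (0 : ℝ) 1) (hb : b ∈ Set.Icc (0 : ℝ) 1) :
      IntervalIntegrable G volume a b :=
    hG.mono_set (Set.uIcc_subset_uIcc (by simpa using ha) (by simpa using hb))
  rw [intervalIntegral.integral_add hleft hright, hshift,
    intervalIntegral.integral_comp_div _ two_ne_zero,
    intervalIntegral.integral_comp_div _ two_ne_zero, ← smul_add, zero_div, add_zero,
    one_add_one_eq_two, div_self two_ne_zero, intervalIntegral.integral_add_adjacent_intervals]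
  · exact hsub (by norm_num) (by norm_num)
  · exact hsub (by norm_num) (by norm_num)

theorem norm_sub_intervalIntegral_le [CompleteSpace E] {G : ℝ → E}
    (hG : IntervalIntegrable G volume 0 1) {β : ℝ}
    (hβ : ∀ x ∈ Set.Icc (0 : ℝ) 1, ∀ x' ∈ Set.Icc (0 : ℝ) 1, ‖G x - G x'‖ ≤ β)
    {x : ℝ} (hx : x ∈ Set.Icc (0 : ℝ) 1) : ‖G x - ∫ u in (0 : ℝ)..1, G u‖ ≤ β := by
  have hconst : ∫ u in (0 : ℝ)..1, (G x - G u) = G x - ∫ u in (0 : ℝ)..1, G u := by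
    rw [intervalIntegral.integral_sub intervalIntegrable_const hG]
    simp
  rw [← hconst]
  have hbound : ∀ u ∈ Set.uIoc (0 : ℝ) 1, ‖G x - G u‖ ≤ β := fun u hu => by
    rw [Set.uIoc_of_le zero_le_one] at hu
    exact hβ x hx u (Set.Ioc_subset_Icc_self hu)
  simpa using intervalIntegral.norm_integral_le_of_norm_le_const hbound

/-- Splitting off the lowest binary digit of `m` replaces `G` by the sum of `G` over its two halves;
this leaves at most one unpaired point per digit, whose error is an oscillation. -/
theorem norm_sum_sobol_sub_integral_le [CompleteSpace E] (m : ℕ) : ∀ {G : ℝ → E},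
    IntervalIntegrable G volume 0 1 → ∀ {β : ℕ → ℝ},
    (∀ k, ∀ x ∈ Set.Icc (0 : ℝ) 1, ∀ x' ∈ Set.Icc (0 : ℝ) 1,
      ‖gridSum k G x - gridSum k G x'‖ ≤ β k) →
    ‖∑ j ∈ Finset.range m, G (sobol j) - (m : ℝ) • ∫ u in (0 : ℝ)..1, G u‖ ≤
      ∑ k ∈ Finset.range m.size, β k := by
  induction m using Nat.binaryRec' with
  | zero => simp
  | bit b p hb ih =>
    intro G hG β hβ
    have hpairs := ih ((intervalIntegrable_comp_half hG).1.add (intervalIntegrable_comp_half hG).2)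
      (β := fun k => β (k + 1)) fun k x hx x' hx' => by
        simpa only [← gridSum_succ, Pi.add_def] using hβ (k + 1) x hx x' hx'
    rw [intervalIntegral_comp_half_add hG, ← sum_range_sobol_two_mul, smul_smul] at hpairs
    have hlast : ‖G (sobol (2 * p)) - ∫ u in (0 : ℝ)..1, G u‖ ≤ β 0 :=
      norm_sub_intervalIntegral_le hG (by simpa only [gridSum_zero] using hβ 0) (sobol_mem_Icc _)
    rw [Nat.size_bit (Nat.bit_ne_zero_iff.2 hb), Finset.sum_range_succ', Nat.bit_val]
    cases b
    · simpa [mul_comm] using hpairs.trans (le_add_of_nonneg_right ((norm_nonneg _).trans hlast))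
    · refine le_trans (le_of_eq_of_le ?_ (norm_add_le _ _)) (add_le_add hpairs hlast)
      simp only [Bool.toNat_true, Finset.sum_range_succ]
      congr 1
      push_cast
      module

theorem natSize_le_three_mul_log {m : ℕ} (hm : 2 ≤ m) : (m.size : ℝ) ≤ 3 * Real.log m := by
  obtain ⟨N, hN⟩ : ∃ N, m.size = N + 1 :=
    Nat.exists_eq_succ_of_ne_zero (Nat.size_pos.2 (by lia)).ne'
  have hpow : 2 ^ N ≤ m := Nat.lt_size.1 (by lia)
  have hlog : N * Real.log 2 ≤ Real.log m := by
    rw [← Real.log_pow]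
    exact Real.log_le_log (by positivity) (by exact_mod_cast hpow)
  have hlog2 : Real.log 2 ≤ Real.log m := Real.log_le_log (by norm_num) (by exact_mod_cast hm)
  have := Real.log_two_gt_d9
  rw [hN]
  push_cast
  nlinarith

end VanDerCorput

section NearlyAffine

/-- All chords of `f` between points of `s` have a slope within `ε` of `p`. This is
`ApproximatesLinearOn` for real functions, with a real `ε`; for `p = 0` it says that `f` is
`ε`-Lipschitz on `s`. -/
def ChordSlopesNear (f : ℝ → ℝ) (p ε : ℝ) (s : Set ℝ) : Prop :=
  ∀ x ∈ s, ∀ y ∈ s, |f x - f y - p * (x - y)| ≤ ε * |x - y|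

/-- The interval between two neighbouring points of the grid of mesh `2⁻ᵏ`. -/
def dyadicCell (k i : ℕ) : Set ℝ := Set.Icc (i / 2 ^ k) ((i + 1) / 2 ^ k)

theorem left_mem_dyadicCell (k i : ℕ) : (i / 2 ^ k : ℝ) ∈ dyadicCell k i :=
  ⟨le_rfl, by gcongr; linarith⟩

theorem right_mem_dyadicCell (k i : ℕ) : ((i + 1) / 2 ^ k : ℝ) ∈ dyadicCell k i :=
  ⟨by gcongr; linarith, le_rfl⟩

theorem abs_sub_left_le_of_mem_dyadicCell {k i : ℕ} {x : ℝ} (hx : x ∈ dyadicCell k i) :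
    |x - i / 2 ^ k| ≤ (1 / 2) ^ k := by
  have hmesh : ((i + 1) / 2 ^ k : ℝ) = i / 2 ^ k + (1 / 2) ^ k := by
    rw [add_div, div_pow, one_pow]
  rw [abs_of_nonneg (sub_nonneg.2 hx.1)]
  linarith [hx.2]

theorem dyadicCell_subset_Icc {k i : ℕ} (hi : i < 2 ^ k) : dyadicCell k i ⊆ Set.Icc 0 1 := by
  have hi' : (i + 1 : ℝ) ≤ 2 ^ k := mod_cast hi
  exact Set.Icc_subset_Icc (by positivity) (div_le_one_of_le₀ hi' (by positivity))

namespace ChordSlopesNear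

variable {f g : ℝ → ℝ} {p q ε c : ℝ} {s : Set ℝ}

theorem mono {t : Set ℝ} (hf : ChordSlopesNear f p ε s) (hts : t ⊆ s) : ChordSlopesNear f p ε t :=
  fun x hx y hy => hf x (hts hx) y (hts hy)

theorem mono_right {ε' : ℝ} (hf : ChordSlopesNear f p ε s) (hε : ε ≤ ε') :
    ChordSlopesNear f p ε' s := fun x hx y hy =>
  (hf x hx y hy).trans (mul_le_mul_of_nonneg_right hε (abs_nonneg _))

theorem abs_sub_le (hf : ChordSlopesNear f p ε s) {x y : ℝ} (hx : x ∈ s) (hy : y ∈ s) :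
    |f x - f y| ≤ (|p| + ε) * |x - y| := by
  have h := abs_add_le (p * (x - y)) (f x - f y - p * (x - y))
  rw [add_sub_cancel, abs_mul] at h
  linarith [hf x hx y hy]

theorem continuousOn (hf : ChordSlopesNear f p ε s) : ContinuousOn f s :=
  (LipschitzOnWith.of_dist_le' (K := |p| + ε) fun _ hx _ hy => hf.abs_sub_le hx hy).continuousOn

theorem posPart_zero (hf : ChordSlopesNear f p ε s) :
    ChordSlopesNear (fun x => max (f x) 0) 0 (|p| + ε) s := fun x hx y hy => by
  simpa using (abs_max_sub_max_le_abs (f x) (f y) 0).trans (hf.abs_sub_le hx hy)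

theorem exists_posPart_of_sign (hε : 0 ≤ ε) (hf : ChordSlopesNear f p ε s)
    (hsign : (∀ x ∈ s, 0 ≤ f x) ∨ ∀ x ∈ s, f x ≤ 0) :
    ∃ p', ChordSlopesNear (fun x => max (f x) 0) p' ε s := by
  rcases hsign with hpos | hneg
  · refine ⟨p, fun x hx y hy => ?_⟩
    beta_reduce
    rw [max_eq_left (hpos x hx), max_eq_left (hpos y hy)]
    exact hf x hx y hy
  · refine ⟨0, fun x hx y hy => ?_⟩
    beta_reduce
    rw [max_eq_right (hneg x hx), max_eq_right (hneg y hy)]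
    simpa using mul_nonneg hε (abs_nonneg (x - y))

theorem posPart_sub_ramp (hε : 0 ≤ ε) (hq : ε < |q|) (hf : ChordSlopesNear f q ε s) (hc : c ∈ s)
    (hfc : f c = 0) :
    ChordSlopesNear (fun x => max (f x) 0 - max (q * (x - c)) 0) 0 ε s := by
  have hclose (x) (hx : x ∈ s) : |f x - q * (x - c)| ≤ ε * |x - c| := by
    simpa [hfc] using hf x hx c hc
  have hle (x) (hx : x ∈ s) : |f x - q * (x - c)| ≤ |q * (x - c)| :=
    (hclose x hx).trans (abs_mul q _ ▸ mul_le_mul_of_nonneg_right hq.le (abs_nonneg _))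
  have hpos {x} (hx : x ∈ s) (h : 0 ≤ q * (x - c)) :
      max (f x) 0 - max (q * (x - c)) 0 = f x - q * (x - c) := by
    have := (abs_le.1 (abs_of_nonneg h ▸ hle x hx)).1
    rw [max_eq_left h, max_eq_left (by linarith)]
  have hneg {x} (hx : x ∈ s) (h : q * (x - c) ≤ 0) :
      max (f x) 0 - max (q * (x - c)) 0 = 0 := by
    have := (abs_le.1 (abs_of_nonpos h ▸ hle x hx)).2
    rw [max_eq_right h, max_eq_right (by linarith), sub_zero]
  have hopposite {x y} (hx : x ∈ s) (h : 0 ≤ q * (x - c)) (h' : q * (y - c) ≤ 0) :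
      |f x - q * (x - c)| ≤ ε * |x - y| := by
    have hdist : |x - c| ≤ |x - y| := by
      refine le_of_mul_le_mul_left ?_ (hε.trans_lt hq)
      calc |q| * |x - c| = q * (x - c) := by rw [← abs_mul, abs_of_nonneg h]
        _ ≤ q * (x - y) := by linarith
        _ ≤ |q| * |x - y| := abs_mul q _ ▸ le_abs_self _
    exact (hclose x hx).trans (mul_le_mul_of_nonneg_left hdist hε)
  intro x hx y hy
  beta_reduce
  rw [zero_mul, sub_zero]
  rcases le_total 0 (q * (x - c)) with h | h <;> rcases le_total 0 (q * (y - c)) with h' | h'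
  · rw [hpos hx h, hpos hy h']
    convert hf x hx y hy using 2
    ring
  · rw [hpos hx h, hneg hy h', sub_zero]
    exact hopposite hx h h'
  · rw [hneg hx h, hpos hy h', zero_sub, abs_neg, abs_sub_comm x]
    exact hopposite hy h' h
  · rw [hneg hx h, hneg hy h', sub_zero, abs_zero]
    positivity

/-- Near a zero `c` the function is close to the ramp `(q (x - c))⁺`, unless `q` is small. -/
theorem exists_posPart_sub_ramp {u v : ℝ} (hε : 0 ≤ ε) (hf : ChordSlopesNear f q ε (Set.Icc u v)) :
    ∃ (p' q' c : ℝ), |q'| ≤ |q| ∧ ChordSlopesNear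
      (fun x => max (f x) 0 - max (q' * (x - c)) 0) p' (2 * ε) (Set.Icc u v) := by
  rcases le_or_gt |q| ε with hq | hq
  · exact ⟨0, 0, 0, by simp, by simpa using hf.posPart_zero.mono_right (by linarith)⟩
  by_cases hzero : ∃ c ∈ Set.Icc u v, f c = 0
  · obtain ⟨c, hc, hfc⟩ := hzero
    exact ⟨0, q, c, le_rfl, (hf.posPart_sub_ramp hε hq hc hfc).mono_right (by linarith)⟩
  · have hsign : (∀ x ∈ Set.Icc u v, 0 ≤ f x) ∨ ∀ x ∈ Set.Icc u v, f x ≤ 0 := by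
      by_contra! ⟨⟨x, hx, hfx⟩, y, hy, hfy⟩
      obtain ⟨c, hc, hfc⟩ := isPreconnected_Icc.intermediate_value hx hy hf.continuousOn
        ⟨hfx.le, hfy.le⟩
      exact hzero ⟨c, hc, hfc⟩
    obtain ⟨p', hp'⟩ := hf.exists_posPart_of_sign hε hsign
    exact ⟨p', 0, 0, by simp, by simpa using hp'.mono_right (by linarith)⟩

theorem const_mul_sub (q c : ℝ) (s : Set ℝ) : ChordSlopesNear (fun x => q * (x - c)) q 0 s :=
  fun x _ y _ => by simp [← mul_sub]

theorem comp_grid_point {k i : ℕ} (hf : ChordSlopesNear f p ε (dyadicCell k i)) :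
    ChordSlopesNear (fun u => f ((i + u) / 2 ^ k)) (p / 2 ^ k) (ε / 2 ^ k) (Set.Icc 0 1) :=
  fun u hu v hv => by
    have hmem {w : ℝ} (hw : w ∈ Set.Icc (0 : ℝ) 1) : (i + w) / 2 ^ k ∈ dyadicCell k i :=
      ⟨by gcongr; linarith [hw.1], by gcongr; exact hw.2⟩
    have h := hf _ (hmem hu) _ (hmem hv)
    rw [← sub_div, add_sub_add_left_eq_sub, abs_div, abs_of_pos (by positivity : (0 : ℝ) < 2 ^ k)]
      at h
    rwa [div_mul_eq_mul_div, div_mul_eq_mul_div, mul_div_assoc, mul_div_assoc]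

end ChordSlopesNear

/-- The change of a grid sum between two offsets, minus the change that a linear interpolation of
`G` on the cells of the grid would have. -/
def gridDefect (k : ℕ) (G : ℝ → ℝ) (x x' : ℝ) : ℝ :=
  gridSum k G x - gridSum k G x' - (x - x') * (G 1 - G 0)

theorem gridDefect_add_fun (k : ℕ) (F G : ℝ → ℝ) (x x' : ℝ) :
    gridDefect k (fun u => F u + G u) x x' = gridDefect k F x x' + gridDefect k G x x' := by
  simp only [gridDefect, gridSum, Finset.sum_add_distrib]
  ring

theorem gridDefect_add (k r : ℕ) (G : ℝ → ℝ) (x x' : ℝ) :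
    gridDefect (k + r) G x x' =
      ∑ i ∈ Finset.range (2 ^ k), gridDefect r (fun u => G ((i + u) / 2 ^ k)) x x' := by
  have htelescope : ∑ i ∈ Finset.range (2 ^ k), (G ((i + 1) / 2 ^ k) - G ((i + 0) / 2 ^ k)) =
      G 1 - G 0 := by
    simpa using Finset.sum_range_sub (fun i : ℕ => G (i / 2 ^ k)) (2 ^ k)
  simp only [gridDefect, gridSum_add k r, Finset.sum_sub_distrib, ← Finset.mul_sum, ← htelescope]

section Bounds

variable {x x' : ℝ} (hx : x ∈ Set.Icc (0 : ℝ) 1) (hx' : x' ∈ Set.Icc (0 : ℝ) 1)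
include hx hx'

theorem abs_gridDefect_le {G : ℝ → ℝ} {p ε : ℝ}
    (hG : ChordSlopesNear G p ε (Set.Icc 0 1)) (k : ℕ) : |gridDefect k G x x'| ≤ 2 * ε := by
  have hε : 0 ≤ ε := by simpa using (abs_nonneg _).trans (hG 1 (by simp) 0 (by simp))
  have hdist : |x - x'| ≤ 1 := by simpa [Real.dist_eq] using Real.dist_le_of_mem_Icc hx hx'
  have hcell : ∀ i ∈ Finset.range (2 ^ k),
      |gridDefect 0 (fun u => G ((i + u) / 2 ^ k)) x x'| ≤ 2 * ε / 2 ^ k := fun i hi => by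
    have hGi := (hG.mono (dyadicCell_subset_Icc (Finset.mem_range.1 hi))).comp_grid_point
    have h := hGi x hx x' hx'
    have h' := hGi 1 (by simp) 0 (by simp)
    rw [sub_zero, mul_one, abs_one, mul_one] at h'
    have hsplit : gridDefect 0 (fun u => G ((i + u) / 2 ^ k)) x x' =
        (G ((i + x) / 2 ^ k) - G ((i + x') / 2 ^ k) - p / 2 ^ k * (x - x')) -
          (x - x') * (G ((i + 1) / 2 ^ k) - G ((i + 0) / 2 ^ k) - p / 2 ^ k) := by
      rw [gridDefect, gridSum_zero, gridSum_zero]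
      ring
    calc |gridDefect 0 (fun u => G ((i + u) / 2 ^ k)) x x'|
        ≤ ε / 2 ^ k * |x - x'| + |x - x'| * (ε / 2 ^ k) := by
          rw [hsplit]
          refine (abs_sub _ _).trans (add_le_add h ?_)
          rw [abs_mul]
          gcongr
      _ = 2 * ε / 2 ^ k * |x - x'| := by ring
      _ ≤ 2 * ε / 2 ^ k := mul_le_of_le_one_right (by positivity) hdist
  rw [← add_zero k, gridDefect_add]
  refine (Finset.abs_sum_le_sum_abs _ _).trans ((Finset.sum_le_card_nsmul _ _ _ hcell).trans ?_)
  rw [Finset.card_range, nsmul_eq_mul]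
  push_cast
  rw [mul_div_cancel₀ _ (by positivity)]

/-- Only the cell that contains `c` contributes. -/
theorem abs_gridDefect_ramp_le (q c : ℝ) (k : ℕ) :
    |gridDefect k (fun u => max (q * (u - c)) 0) x x'| ≤ 2 * |q| / 2 ^ k := by
  have hcell (i : ℕ) : |gridDefect 0 (fun u => max (q * ((i + u) / 2 ^ k - c)) 0) x x'| ≤
      if i = ⌊c * 2 ^ k⌋₊ then 2 * |q| / 2 ^ k else 0 := by
    have hslopes := (ChordSlopesNear.const_mul_sub q c (dyadicCell k i)).comp_grid_point
    split_ifs with hi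
    · refine (abs_gridDefect_le hx hx' hslopes.posPart_zero 0).trans_eq ?_
      rw [zero_div, add_zero, abs_div, abs_of_pos (by positivity : (0 : ℝ) < 2 ^ k), mul_div_assoc]
    · have hside : (∀ u ∈ Set.Icc (0 : ℝ) 1, 0 ≤ (i + u) / 2 ^ k - c) ∨
          ∀ u ∈ Set.Icc (0 : ℝ) 1, (i + u) / 2 ^ k - c ≤ 0 := by
        simp only [sub_nonneg, sub_nonpos, div_le_iff₀ (by positivity : (0 : ℝ) < 2 ^ k),
          le_div_iff₀ (by positivity : (0 : ℝ) < 2 ^ k)]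
        rcases lt_or_gt_of_ne hi with hlt | hgt
        · have := (Nat.le_floor_iff' i.succ_ne_zero).1 (Nat.succ_le_of_lt hlt)
          push_cast at this
          exact .inr fun u hu => by linarith [hu.2]
        · exact .inl fun u hu => by linarith [Nat.lt_of_floor_lt hgt, hu.1]
      obtain ⟨p', hp'⟩ := hslopes.exists_posPart_of_sign (by simp) <| by
        rcases hside with h | h <;> rcases le_total 0 q with hq | hq
        · exact .inl fun u hu => mul_nonneg hq (h u hu)
        · exact .inr fun u hu => mul_nonpos_of_nonpos_of_nonneg hq (h u hu)
        · exact .inr fun u hu => mul_nonpos_of_nonneg_of_nonpos hq (h u hu)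
        · exact .inl fun u hu => mul_nonneg_of_nonpos_of_nonpos hq (h u hu)
      simpa using abs_gridDefect_le hx hx' hp' 0
  rw [← add_zero k, gridDefect_add]
  refine (Finset.abs_sum_le_sum_abs _ _).trans ((Finset.sum_le_sum fun i _ => hcell i).trans ?_)
  rw [Finset.sum_ite_eq', add_zero]
  split_ifs
  exacts [le_rfl, by positivity]

theorem abs_gridDefect_posPart_le {b : ℝ → ℝ} {q ε : ℝ}
    (hb : ChordSlopesNear b q ε (Set.Icc 0 1)) (k : ℕ) :
    |gridDefect k (fun u => max (b u) 0) x x'| ≤ 4 * ε + 2 * |q| / 2 ^ k := by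
  have hε : 0 ≤ ε := by simpa using (abs_nonneg _).trans (hb 1 (by simp) 0 (by simp))
  obtain ⟨p', q', c, hq', hp'⟩ := hb.exists_posPart_sub_ramp hε
  have hramp : |gridDefect k (fun u => max (q' * (u - c)) 0) x x'| ≤ 2 * |q| / 2 ^ k :=
    (abs_gridDefect_ramp_le hx hx' q' c k).trans (by gcongr)
  have hrest := abs_gridDefect_le hx hx' hp' k
  have hsum := gridDefect_add_fun k (fun u => max (b u) 0 - max (q' * (u - c)) 0)
    (fun u => max (q' * (u - c)) 0) x x'
  simp only [sub_add_cancel] at hsum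
  rw [hsum]
  exact (abs_add_le _ _).trans (by linarith)

/-- The positive part is not nearly affine on the few coarse cells where `b` has a zero, but in each
of these the defect comes from a single fine cell. -/
theorem abs_gridSum_sub_le_of_nearly_affine {a b : ℝ → ℝ} {ε L : ℝ} {k : ℕ}
    (hab : ∀ i < 2 ^ k, ∃ p q, |q| ≤ L ∧ ChordSlopesNear a p ε (dyadicCell k i) ∧
      ChordSlopesNear b q ε (dyadicCell k i)) (r : ℕ) :
    |gridSum (k + r) (fun s => a s + max (b s) 0) x -
        gridSum (k + r) (fun s => a s + max (b s) 0) x'| ≤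
      |(a 1 + max (b 1) 0) - (a 0 + max (b 0) 0)| + 6 * ε + 2 * L / 2 ^ r := by
  set G : ℝ → ℝ := fun s => a s + max (b s) 0 with hG
  have hcell : ∀ i ∈ Finset.range (2 ^ k), |gridDefect r (fun u => G ((i + u) / 2 ^ k)) x x'| ≤
      (6 * ε + 2 * L / 2 ^ r) / 2 ^ k := fun i hi => by
    obtain ⟨p, q, hq, ha, hb⟩ := hab i (Finset.mem_range.1 hi)
    have hadefect := abs_gridDefect_le hx hx' ha.comp_grid_point r
    have hbdefect := abs_gridDefect_posPart_le hx hx' hb.comp_grid_point r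
    rw [hG, gridDefect_add_fun]
    refine (abs_add_le _ _).trans ((add_le_add hadefect hbdefect).trans ?_)
    calc 2 * (ε / 2 ^ k) + (4 * (ε / 2 ^ k) + 2 * |q / 2 ^ k| / 2 ^ r)
        = (6 * ε + 2 * |q| / 2 ^ r) / 2 ^ k := by
          rw [abs_div, abs_of_pos (by positivity : (0 : ℝ) < 2 ^ k)]
          ring
      _ ≤ (6 * ε + 2 * L / 2 ^ r) / 2 ^ k := by gcongr
  have hdefect : |gridDefect (k + r) G x x'| ≤ 6 * ε + 2 * L / 2 ^ r := by
    rw [gridDefect_add]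
    refine (Finset.abs_sum_le_sum_abs _ _).trans ((Finset.sum_le_card_nsmul _ _ _ hcell).trans ?_)
    rw [Finset.card_range, nsmul_eq_mul]
    push_cast
    rw [mul_div_cancel₀ _ (by positivity)]
  have hlinear : |(x - x') * (G 1 - G 0)| ≤ |G 1 - G 0| := by
    rw [abs_mul]
    refine mul_le_of_le_one_left (abs_nonneg _) ?_
    simpa [Real.dist_eq] using Real.dist_le_of_mem_Icc hx hx'
  have h := abs_add_le (gridDefect (k + r) G x x') ((x - x') * (G 1 - G 0))
  rw [gridDefect, sub_add_cancel] at h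
  exact h.trans (by rw [← gridDefect]; linarith)

end Bounds

end NearlyAffine

section Quantile

theorem Task.lo_lt_hi (τ : Task) : τ.lo < τ.hi := by
  cases τ <;> norm_num [Task.lo, Task.hi]

theorem setOf_coe_le_hi (τ : Task) : {s : τ.Hyper | (s : ℝ) ≤ τ.hi} = Set.univ :=
  Set.eq_univ_of_forall fun s => s.2.2

variable {τ : Task} (μ : Measure τ.Hyper) [IsProbabilityMeasure μ]

theorem measureReal_coe_le_eq_cdf (t : ℝ) :
    μ.real {s : τ.Hyper | (s : ℝ) ≤ t} = ProbabilityTheory.cdf (μ.map Subtype.val) t := by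
  have : IsProbabilityMeasure (μ.map (Subtype.val : τ.Hyper → ℝ)) :=
    Measure.isProbabilityMeasure_map measurable_subtype_coe.aemeasurable
  rw [ProbabilityTheory.cdf_eq_real, map_measureReal_apply measurable_subtype_coe measurableSet_Iic]
  rfl

theorem hi_mem_setOf_le_measureReal {u : ℝ} (hu : u ≤ 1) :
    τ.hi ∈ {t : ℝ | τ.lo ≤ t ∧ u ≤ μ.real {s : τ.Hyper | (s : ℝ) ≤ t}} :=
  ⟨τ.lo_le_hi, by rwa [setOf_coe_le_hi, probReal_univ]⟩

theorem coe_quantile {u : ℝ} (hu : u ≤ 1) : (quantile τ μ u : ℝ) =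
    sInf {t : ℝ | τ.lo ≤ t ∧ u ≤ μ.real {s : τ.Hyper | (s : ℝ) ≤ t}} := by
  have hhi := hi_mem_setOf_le_measureReal μ hu
  rw [quantile, Set.projIcc_of_mem _
    ⟨le_csInf ⟨_, hhi⟩ fun t ht => ht.1, csInf_le ⟨τ.lo, fun t ht => ht.1⟩ hhi⟩]

theorem quantile_le_iff {u : ℝ} (hu : u ≤ 1) (t : τ.Hyper) :
    quantile τ μ u ≤ t ↔ u ≤ μ.real {s : τ.Hyper | (s : ℝ) ≤ t} := by
  rw [← Subtype.coe_le_coe, coe_quantile μ hu]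
  refine ⟨fun h => ?_, fun h => csInf_le ⟨τ.lo, fun t ht => ht.1⟩ ⟨t.2.1, h⟩⟩
  have hcont := (ProbabilityTheory.cdf (μ.map (Subtype.val : τ.Hyper → ℝ))).right_continuous t
  rw [measureReal_coe_le_eq_cdf]
  refine ge_of_tendsto (hcont.mono Set.Ioi_subset_Ici_self) ?_
  filter_upwards [self_mem_nhdsWithin] with t' ht'
  obtain ⟨r, ⟨-, hr⟩, hrt⟩ :=
    exists_lt_of_csInf_lt ⟨_, hi_mem_setOf_le_measureReal μ hu⟩ (h.trans_lt ht')
  rw [measureReal_coe_le_eq_cdf] at hr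
  exact hr.trans (ProbabilityTheory.monotone_cdf _ hrt.le)

theorem monotoneOn_quantile : MonotoneOn (quantile τ μ) (Set.Iic 1) := fun u hu u' hu' h => by
  rw [quantile_le_iff μ hu]
  exact h.trans ((quantile_le_iff μ hu' _).1 le_rfl)

theorem aemeasurable_quantile :
    AEMeasurable (quantile τ μ) (volume.restrict (Set.Ioc (0 : ℝ) 1)) :=
  aemeasurable_restrict_of_monotoneOn measurableSet_Ioc
    ((monotoneOn_quantile μ).mono fun _ hu => hu.2)

theorem map_quantile : (volume.restrict (Set.Ioc (0 : ℝ) 1)).map (quantile τ μ) = μ := by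
  have : IsProbabilityMeasure (volume.restrict (Set.Ioc (0 : ℝ) 1)) := ⟨by simp⟩
  have : IsProbabilityMeasure ((volume.restrict (Set.Ioc (0 : ℝ) 1)).map (quantile τ μ)) :=
    Measure.isProbabilityMeasure_map (aemeasurable_quantile μ)
  refine Measure.ext_of_Iic _ _ fun t => ?_
  have hpreimage : quantile τ μ ⁻¹' Set.Iic t ∩ Set.Ioc (0 : ℝ) 1 =
      Set.Ioc 0 (μ.real (Set.Iic t)) := by
    ext u
    exact ⟨fun ⟨hut, hu0, hu1⟩ => ⟨hu0, (quantile_le_iff μ hu1 t).1 hut⟩, fun ⟨hu0, hut⟩ =>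
      ⟨(quantile_le_iff μ (hut.trans measureReal_le_one) t).2 hut, hu0,
        hut.trans measureReal_le_one⟩⟩
  rw [Measure.map_apply_of_aemeasurable (aemeasurable_quantile μ) measurableSet_Iic,
    Measure.restrict_apply' measurableSet_Ioc, hpreimage, Real.volume_Ioc, sub_zero,
    ofReal_measureReal]

theorem integral_comp_quantile {g : τ.Hyper → ℝ} (hg : Continuous g) :
    ∫ u in (0 : ℝ)..1, g (quantile τ μ u) = ∫ θ, g θ ∂μ := by
  rw [intervalIntegral.integral_of_le zero_le_one,
    ← integral_map (aemeasurable_quantile μ) hg.aestronglyMeasurable, map_quantile]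

theorem intervalIntegrable_comp_quantile {g : τ.Hyper → ℝ} (hg : Continuous g) :
    IntervalIntegrable (fun u => g (quantile τ μ u)) volume 0 1 := by
  rw [intervalIntegrable_iff_integrableOn_Ioc_of_le zero_le_one]
  refine (integrable_map_measure hg.aestronglyMeasurable (aemeasurable_quantile μ)).1 ?_
  rw [map_quantile]
  exact hg.integrable_of_hasCompactSupport (HasCompactSupport.of_compactSpace g)

theorem uniform_setOf_coe_le {t : ℝ} (ht : t ∈ Set.Icc τ.lo τ.hi) :
    τ.uniform {s : τ.Hyper | (s : ℝ) ≤ t} = ENNReal.ofReal ((t - τ.lo) / (τ.hi - τ.lo)) := by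
  have himage : (Subtype.val : τ.Hyper → ℝ) '' {s : τ.Hyper | (s : ℝ) ≤ t} = Set.Icc τ.lo t := by
    ext r
    exact ⟨fun ⟨s, hs, hsr⟩ => hsr ▸ ⟨s.2.1, hs⟩, fun hr => ⟨⟨r, hr.1, hr.2.trans ht.2⟩, hr.2, rfl⟩⟩
  rw [Task.uniform, Measure.smul_apply,
    (MeasurableEmbedding.subtype_coe measurableSet_Icc).comap_apply, himage, Real.volume_Icc,
    smul_eq_mul, mul_comm, ← div_eq_mul_inv, ENNReal.ofReal_div_of_pos (sub_pos.2 τ.lo_lt_hi)]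

theorem isProbabilityMeasure_uniform (τ : Task) : IsProbabilityMeasure τ.uniform := by
  refine ⟨?_⟩
  rw [← setOf_coe_le_hi, uniform_setOf_coe_le (Set.right_mem_Icc.2 τ.lo_le_hi),
    div_self (sub_pos.2 τ.lo_lt_hi).ne', ENNReal.ofReal_one]

theorem coe_quantile_uniform (τ : Task) {u : ℝ} (hu : u ∈ Set.Icc (0 : ℝ) 1) :
    (quantile τ τ.uniform u : ℝ) = τ.lo + (τ.hi - τ.lo) * u := by
  have := isProbabilityMeasure_uniform τ
  have hlength : 0 < τ.hi - τ.lo := sub_pos.2 τ.lo_lt_hi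
  have hle (t : τ.Hyper) : quantile τ τ.uniform u ≤ t ↔ τ.lo + (τ.hi - τ.lo) * u ≤ t := by
    rw [quantile_le_iff τ.uniform hu.2, Measure.real, uniform_setOf_coe_le t.2,
      ENNReal.toReal_ofReal (div_nonneg (sub_nonneg.2 t.2.1) hlength.le), le_div_iff₀ hlength,
      le_sub_iff_add_le', mul_comm]
  have hmem : τ.lo + (τ.hi - τ.lo) * u ∈ Set.Icc τ.lo τ.hi :=
    ⟨by nlinarith [hu.1], by nlinarith [hu.2]⟩
  exact le_antisymm ((hle ⟨_, hmem⟩).2 le_rfl) ((hle _).1 le_rfl)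

end Quantile

section Rademacher

/-- The sign `±1` encoded by a Boolean; a sum over `Fin n → Bool` is then, up to the factor `2ⁿ`, an
expectation over independent Rademacher variables. -/
def boolSign (b : Bool) : ℝ := if b then 1 else -1

@[simp] theorem boolSign_true : boolSign true = 1 := rfl

@[simp] theorem boolSign_false : boolSign false = -1 := rfl

theorem boolSign_not (b : Bool) : boolSign (!b) = -boolSign b := by cases b <;> simp

theorem abs_boolSign (b : Bool) : |boolSign b| = 1 := by cases b <;> simp

theorem sum_signs_succ {M : Type*} [AddCommMonoid M] {n : ℕ} (F : (Fin (n + 1) → Bool) → M) :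
    ∑ ε, F ε = ∑ ε : Fin n → Bool, (F (Fin.cons true ε) + F (Fin.cons false ε)) := by
  rw [← (Fin.consEquiv fun _ => Bool).sum_comp, Fintype.sum_prod_type, Fintype.sum_bool,
    ← Finset.sum_add_distrib]
  rfl

section Contraction

variable {ι : Type*}

theorem exists_abs_add_le {u v : ι → ℝ} (hu : ∃ C, ∀ t, |u t| ≤ C) (hv : ∃ C, ∀ t, |v t| ≤ C) :
    ∃ C, ∀ t, |u t + v t| ≤ C := by
  obtain ⟨C, hC⟩ := hu
  obtain ⟨D, hD⟩ := hv
  exact ⟨C + D, fun t => (abs_add_le _ _).trans (add_le_add (hC t) (hD t))⟩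

theorem exists_abs_comp_le {a : ι → ℝ} {φ : ℝ → ℝ} (ha : ∃ C, ∀ t, |a t| ≤ C)
    (hφ : LipschitzWith 1 φ) : ∃ C, ∀ t, |φ (a t)| ≤ C := by
  obtain ⟨C, hC⟩ := ha
  refine ⟨C + |φ 0|, fun t => ?_⟩
  have hlip : |φ (a t) - φ 0| ≤ |a t| := by simpa [Real.dist_eq] using hφ.dist_le_mul (a t) 0
  linarith [abs_sub_abs_le_abs_sub (φ (a t)) (φ 0), hC t]

theorem exists_abs_sum_signs_le {n : ℕ} {a : Fin n → ι → ℝ} (ha : ∀ i, ∃ C, ∀ t, |a i t| ≤ C)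
    (ε : Fin n → Bool) : ∃ C, ∀ t, |∑ i, boolSign (ε i) * a i t| ≤ C := by
  choose A hA using ha
  refine ⟨∑ i, A i, fun t => (Finset.abs_sum_le_sum_abs _ _).trans ?_⟩
  exact Finset.sum_le_sum fun i _ => by rw [abs_mul, abs_boolSign, one_mul]; exact hA i t

variable [Nonempty ι]

theorem iSup_add_iSup_contraction {u a : ι → ℝ} {φ : ℝ → ℝ} (hu : ∃ C, ∀ t, |u t| ≤ C)
    (ha : ∃ C, ∀ t, |a t| ≤ C) (hφ : LipschitzWith 1 φ) :
    (⨆ t, (u t + φ (a t))) + (⨆ t, (u t - φ (a t))) ≤ (⨆ t, (u t + a t)) + ⨆ t, (u t - a t) := by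
  have hbdd {b : ι → ℝ} (hb : ∃ C, ∀ t, |b t| ≤ C) : BddAbove (Set.range b) :=
    hb.imp fun _ hC => Set.forall_mem_range.2 fun t => le_of_abs_le (hC t)
  have hadd := hbdd (exists_abs_add_le hu ha)
  have hsub : BddAbove (Set.range fun t => u t - a t) :=
    hbdd (exists_abs_add_le hu (by simpa only [abs_neg] using ha : ∃ C, ∀ t, |-a t| ≤ C))
  refine ciSup_add_ciSup_le fun t t' => ?_
  have hlip : φ (a t) - φ (a t') ≤ |a t - a t'| :=
    le_of_abs_le (by simpa [Real.dist_eq] using hφ.dist_le_mul (a t) (a t'))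
  rcases abs_cases (a t - a t') with h | h
  · linarith [le_ciSup hadd t, le_ciSup hsub t']
  · linarith [le_ciSup hadd t', le_ciSup hsub t]

theorem sum_signs_iSup_contraction {n : ℕ} {u : ι → ℝ} {a : Fin n → ι → ℝ} {φ : Fin n → ℝ → ℝ}
    (hu : ∃ C, ∀ t, |u t| ≤ C) (ha : ∀ i, ∃ C, ∀ t, |a i t| ≤ C) (hφ : ∀ i, LipschitzWith 1 (φ i)) :
    ∑ ε : Fin n → Bool, (⨆ t, (u t + ∑ i, boolSign (ε i) * φ i (a i t))) ≤
      ∑ ε : Fin n → Bool, ⨆ t, (u t + ∑ i, boolSign (ε i) * a i t) := by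
  induction n generalizing u with
  | zero => simp
  | succ n ih =>
    simp only [sum_signs_succ, Fin.sum_univ_succ, Fin.cons_zero, Fin.cons_succ, boolSign_true,
      boolSign_false, one_mul, neg_one_mul]
    have hadd := exists_abs_add_le hu (ha 0)
    have hsub : ∃ C, ∀ t, |u t + -a 0 t| ≤ C :=
      exists_abs_add_le hu (by simpa only [abs_neg] using ha 0)
    have hfirst (ε : Fin n → Bool) :
        (⨆ t, (u t + (φ 0 (a 0 t) + ∑ i, boolSign (ε i) * φ i.succ (a i.succ t)))) +
          (⨆ t, (u t + (-φ 0 (a 0 t) + ∑ i, boolSign (ε i) * φ i.succ (a i.succ t)))) ≤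
        (⨆ t, (u t + a 0 t + ∑ i, boolSign (ε i) * φ i.succ (a i.succ t))) +
          ⨆ t, (u t + -a 0 t + ∑ i, boolSign (ε i) * φ i.succ (a i.succ t)) := by
      have hrest := exists_abs_add_le hu (exists_abs_sum_signs_le
        (fun i : Fin n => exists_abs_comp_le (ha i.succ) (hφ i.succ)) ε)
      convert iSup_add_iSup_contraction hrest (ha 0) (hφ 0) using 4 <;> ring
    refine (Finset.sum_le_sum fun ε _ => hfirst ε).trans ?_
    simpa only [Finset.sum_add_distrib, add_assoc] using
      add_le_add (ih hadd (fun i => ha i.succ) fun i => hφ i.succ)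
        (ih hsub (fun i => ha i.succ) fun i => hφ i.succ)

end Contraction

variable {H : Type*} [NormedAddCommGroup H] [InnerProductSpace ℝ H]

theorem sum_signs_norm_sq {n : ℕ} (v : H) (ψ : Fin n → H) :
    ∑ ε : Fin n → Bool, ‖v + ∑ i, boolSign (ε i) • ψ i‖ ^ 2 =
      2 ^ n * (‖v‖ ^ 2 + ∑ i, ‖ψ i‖ ^ 2) := by
  induction n generalizing v with
  | zero => simp
  | succ n ih =>
    simp only [sum_signs_succ, Fin.sum_univ_succ, Fin.cons_zero, Fin.cons_succ, boolSign_true,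
      boolSign_false, one_smul, neg_smul, ← add_assoc, Finset.sum_add_distrib]
    rw [ih, ih, ← sub_eq_add_neg, pow_succ]
    linear_combination (2 : ℝ) ^ n * parallelogram_law_with_norm ℝ v (ψ 0)

theorem sum_signs_norm_le {n : ℕ} {ψ : Fin n → H} {κ : ℝ} (hκ : 0 ≤ κ) (hψ : ∀ i, ‖ψ i‖ ≤ κ) :
    ∑ ε : Fin n → Bool, ‖∑ i, boolSign (ε i) • ψ i‖ ≤ 2 ^ n * (√n * κ) := by
  refine le_of_sq_le_sq ?_ (by positivity)
  calc (∑ ε : Fin n → Bool, ‖∑ i, boolSign (ε i) • ψ i‖) ^ 2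
      ≤ 2 ^ n * ∑ ε : Fin n → Bool, ‖∑ i, boolSign (ε i) • ψ i‖ ^ 2 := by
        simpa using sq_sum_le_card_mul_sum_sq (s := Finset.univ)
          (f := fun ε : Fin n → Bool => ‖∑ i, boolSign (ε i) • ψ i‖)
    _ = 2 ^ n * (2 ^ n * ∑ i, ‖ψ i‖ ^ 2) := by simpa using sum_signs_norm_sq 0 ψ
    _ ≤ 2 ^ n * (2 ^ n * (n * κ ^ 2)) := by
        gcongr
        simpa using Finset.sum_le_card_nsmul Finset.univ (fun i => ‖ψ i‖ ^ 2) (κ ^ 2)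
          fun i _ => pow_le_pow_left₀ (norm_nonneg _) (hψ i) 2
    _ = (2 ^ n * (√n * κ)) ^ 2 := by
        rw [mul_pow, mul_pow, Real.sq_sqrt (Nat.cast_nonneg n)]
        ring

theorem sum_signs_iSup_closedBall_le {n : ℕ} {ψ : Fin n → H} {φ : Fin n → ℝ → ℝ} {κ ρ : ℝ}
    (hκ : 0 ≤ κ) (hρ : 0 ≤ ρ) (hψ : ∀ i, ‖ψ i‖ ≤ κ) (hφ : ∀ i, LipschitzWith 1 (φ i)) :
    ∑ ε : Fin n → Bool, (⨆ h : Metric.closedBall (0 : H) ρ,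
      ∑ i, boolSign (ε i) * φ i (inner ℝ (h : H) (ψ i))) ≤ 2 ^ n * (√n * (ρ * κ)) := by
  have : Nonempty (Metric.closedBall (0 : H) ρ) := ⟨⟨0, by simpa using hρ⟩⟩
  have hbounded (i : Fin n) : ∃ C, ∀ h : Metric.closedBall (0 : H) ρ, |inner ℝ (h : H) (ψ i)| ≤ C :=
    ⟨ρ * κ, fun h => (abs_real_inner_le_norm _ _).trans
      (mul_le_mul (mem_closedBall_zero_iff.1 h.2) (hψ i) (norm_nonneg _) hρ)⟩
  have hlinear (ε : Fin n → Bool) : (⨆ h : Metric.closedBall (0 : H) ρ,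
      ∑ i, boolSign (ε i) * inner ℝ (h : H) (ψ i)) ≤ ρ * ‖∑ i, boolSign (ε i) • ψ i‖ := by
    refine ciSup_le fun h => ?_
    simp_rw [← real_inner_smul_right, ← inner_sum]
    exact (real_inner_le_norm _ _).trans
      (mul_le_mul_of_nonneg_right (mem_closedBall_zero_iff.1 h.2) (norm_nonneg _))
  calc _ ≤ ∑ ε : Fin n → Bool, ⨆ h : Metric.closedBall (0 : H) ρ,
          ∑ i, boolSign (ε i) * inner ℝ (h : H) (ψ i) := by
        simpa only [zero_add] using
          sum_signs_iSup_contraction (u := fun _ => 0) ⟨0, by simp⟩ hbounded hφ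
    _ ≤ ∑ ε : Fin n → Bool, ρ * ‖∑ i, boolSign (ε i) • ψ i‖ :=
        Finset.sum_le_sum fun ε _ => hlinear ε
    _ ≤ ρ * (2 ^ n * (√n * κ)) := by
        rw [← Finset.mul_sum]
        exact mul_le_mul_of_nonneg_left (sum_signs_norm_le hκ hψ) hρ
    _ = _ := by ring

end Rademacher

section Deviation

variable {H : Type*} [NormedAddCommGroup H] [InnerProductSpace ℝ H]

/-- The radial retraction onto the closed ball of radius `ρ`, for `0 < ρ`. -/
def ballRetract (ρ : ℝ) (v : H) : H := (ρ / max ρ ‖v‖) • v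

section BallRetract

variable {ρ : ℝ} (hρ : 0 < ρ)
include hρ

theorem norm_ballRetract_le (v : H) : ‖ballRetract ρ v‖ ≤ ρ := by
  have hmax : 0 < max ρ ‖v‖ := lt_max_of_lt_left hρ
  rw [ballRetract, norm_smul, Real.norm_of_nonneg (by positivity), div_mul_eq_mul_div,
    div_le_iff₀ hmax]
  exact mul_le_mul_of_nonneg_left (le_max_right _ _) hρ.le

theorem ballRetract_of_norm_le {v : H} (hv : ‖v‖ ≤ ρ) : ballRetract ρ v = v := by
  rw [ballRetract, max_eq_left hv, div_self hρ.ne', one_smul]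

theorem continuous_ballRetract : Continuous (ballRetract ρ : H → H) :=
  (continuous_const.div (by fun_prop) fun _ => (lt_max_of_lt_left hρ).ne').smul continuous_id

end BallRetract

theorem exists_norm_sum_smul_le_inner_eq {ι : Type*} [Fintype ι] (v : ι → H) (h : H) :
    ∃ c : ι → ℝ, ‖∑ k, c k • v k‖ ≤ ‖h‖ ∧
      ∀ j, inner ℝ (∑ k, c k • v k) (v j) = inner ℝ h (v j) := by
  set V : Submodule ℝ H := Submodule.span ℝ (Set.range v)
  have : FiniteDimensional ℝ V := FiniteDimensional.span_of_finite ℝ (Set.finite_range _)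
  obtain ⟨c, hc⟩ := (Submodule.mem_span_range_iff_exists_fun ℝ).1
    (show V.starProjection h ∈ Submodule.span ℝ (Set.range v) from
      V.starProjection_apply_mem h)
  refine ⟨c, hc ▸ V.norm_starProjection_apply_le h, fun j => ?_⟩
  have horth := V.starProjection_inner_eq_zero h (v j) (Submodule.subset_span ⟨j, rfl⟩)
  rw [inner_sub_left, sub_eq_zero] at horth
  exact hc ▸ horth.symm

variable {Z : Type*} {n : ℕ} (ψ : Z → H) (φ : Z → ℝ → ℝ)

/-- The list of the first and second members of `n` pairs. -/
def pairPoint (w : Fin n → Z × Z) (k : Fin n × Bool) : Z :=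
  if k.2 then (w k.1).2 else (w k.1).1

/-- The linear combination with coefficients `c` of the features of the members of `n` pairs. -/
def pairComb (w : Fin n → Z × Z) (c : Fin n × Bool → ℝ) : H :=
  ∑ k, c k • ψ (pairPoint w k)

/-- The difference between the losses of `h` on the second members (a ghost sample) and on the first
members (the sample) of `n` pairs. -/
def pairDev (w : Fin n → Z × Z) (h : H) : ℝ :=
  ∑ i, (φ (w i).2 (inner ℝ h (ψ (w i).2)) - φ (w i).1 (inner ℝ h (ψ (w i).1)))

/-- The positive part of the supremum of `pairDev` over the ball of radius `ρ`. To keep it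
measurable in `w` without a separability assumption on `H`, it is written as a countable supremum
over the rational combinations of the features, retracted to the ball. -/
def supPairDev (ρ : ℝ) (w : Fin n → Z × Z) : ENNReal :=
  ⨆ c : Fin n × Bool → ℚ,
    ENNReal.ofReal (pairDev ψ φ w (ballRetract ρ (pairComb ψ w fun k => (c k : ℝ))))

variable {ψ φ} {ρ κ L : ℝ}

theorem continuous_pairDev (hφ : ∀ z, Continuous (φ z)) (w : Fin n → Z × Z) :
    Continuous (pairDev ψ φ w) :=
  continuous_finsetSum _ fun i _ => ((hφ (w i).2).comp (by fun_prop)).sub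
    ((hφ (w i).1).comp (by fun_prop))

theorem ofReal_pairDev_le_supPairDev (hρ : 0 < ρ) (hφ : ∀ z, Continuous (φ z))
    (w : Fin n → Z × Z) {h : H} (hh : ‖h‖ ≤ ρ) :
    ENNReal.ofReal (pairDev ψ φ w h) ≤ supPairDev ψ φ ρ w := by
  obtain ⟨c, hnorm, hinner⟩ := exists_norm_sum_smul_le_inner_eq (fun k => ψ (pairPoint w k)) h
  have hdev : pairDev ψ φ w h = pairDev ψ φ w (ballRetract ρ (pairComb ψ w c)) := by
    have hretract : ballRetract ρ (pairComb ψ w c) = pairComb ψ w c :=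
      ballRetract_of_norm_le hρ (hnorm.trans hh)
    rw [hretract]
    refine Finset.sum_congr rfl fun i _ => ?_
    have hsecond := hinner (i, true)
    have hfirst := hinner (i, false)
    simp only [pairPoint, if_true, Bool.false_eq_true, if_false] at hsecond hfirst
    rw [← hsecond, ← hfirst]
    rfl
  have hclosed : IsClosed {c : Fin n × Bool → ℝ |
      ENNReal.ofReal (pairDev ψ φ w (ballRetract ρ (pairComb ψ w c))) ≤ supPairDev ψ φ ρ w} := by
    refine isClosed_le (ENNReal.continuous_ofReal.comp ((continuous_pairDev hφ w).comp
      ((continuous_ballRetract hρ).comp ?_))) continuous_const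
    unfold pairComb
    fun_prop
  have hdense : DenseRange (fun (c : Fin n × Bool → ℚ) k => (c k : ℝ)) :=
    DenseRange.piMap fun _ => Rat.denseRange_cast
  rw [hdev]
  exact hdense.induction_on (p := fun c => ENNReal.ofReal
    (pairDev ψ φ w (ballRetract ρ (pairComb ψ w c))) ≤ supPairDev ψ φ ρ w) c hclosed
    fun q => le_iSup_of_le q le_rfl

section Measurability

variable [MeasurableSpace Z]

theorem measurable_pairPoint (k : Fin n × Bool) :
    Measurable fun w : Fin n → Z × Z => pairPoint w k := by
  unfold pairPoint
  split_ifs <;> fun_prop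

theorem measurable_inner_pairComb (hψ : Measurable fun p : Z × Z => inner ℝ (ψ p.1) (ψ p.2))
    (c : Fin n × Bool → ℝ) (k : Fin n × Bool) :
    Measurable fun w : Fin n → Z × Z => inner ℝ (pairComb ψ w c) (ψ (pairPoint w k)) := by
  simp only [pairComb, sum_inner, real_inner_smul_left]
  exact Finset.measurable_sum _ fun i _ => (hψ.comp
    ((measurable_pairPoint i).prodMk (measurable_pairPoint k))).const_mul _

theorem measurable_norm_pairComb (hψ : Measurable fun p : Z × Z => inner ℝ (ψ p.1) (ψ p.2))
    (c : Fin n × Bool → ℝ) : Measurable fun w : Fin n → Z × Z => ‖pairComb ψ w c‖ := by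
  have hnorm (w : Fin n → Z × Z) : ‖pairComb ψ w c‖ =
      √(∑ k, c k * inner ℝ (pairComb ψ w c) (ψ (pairPoint w k))) := by
    simp only [norm_eq_sqrt_real_inner, ← real_inner_smul_right, ← inner_sum]
    rfl
  simp only [hnorm]
  exact (Finset.measurable_sum _ fun k _ => (measurable_inner_pairComb hψ c k).const_mul _).sqrt

theorem measurable_supPairDev (hψ : Measurable fun p : Z × Z => inner ℝ (ψ p.1) (ψ p.2))
    (hφ : Measurable (Function.uncurry φ)) (ρ : ℝ) :
    Measurable (supPairDev ψ φ ρ : (Fin n → Z × Z) → ENNReal) := by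
  refine Measurable.iSup fun c => ENNReal.measurable_ofReal.comp ?_
  have hinner (k : Fin n × Bool) : Measurable fun w : Fin n → Z × Z =>
      inner ℝ (ballRetract ρ (pairComb ψ w fun k => (c k : ℝ))) (ψ (pairPoint w k)) := by
    simp only [ballRetract, real_inner_smul_left]
    exact ((measurable_const.max (measurable_norm_pairComb hψ _)).const_div ρ).mul
      (measurable_inner_pairComb hψ _ k)
  exact Finset.measurable_sum _ fun i _ =>
    (hφ.comp ((measurable_pairPoint (i, true)).prodMk (hinner (i, true)))).sub
      (hφ.comp ((measurable_pairPoint (i, false)).prodMk (hinner (i, false))))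

end Measurability

/-- The sample and the ghost sample with the members of the pairs exchanged where `ε` is `false`. -/
def pairSwap (ε : Fin n → Bool) (w : Fin n → Z × Z) (i : Fin n) : Z × Z :=
  if ε i then w i else (w i).swap

theorem pairDev_pairSwap (ε : Fin n → Bool) (w : Fin n → Z × Z) (h : H) :
    pairDev ψ φ (pairSwap ε w) h = ∑ i, boolSign (ε i) *
      (φ (w i).2 (inner ℝ h (ψ (w i).2)) - φ (w i).1 (inner ℝ h (ψ (w i).1))) :=
  Finset.sum_congr rfl fun i _ => by cases hi : ε i <;> simp [pairSwap, hi]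

/-- An upper bound for the signed sum of the losses of the sample `z` over the ball of radius `ρ`:
the supremum over the ball of the recentred sum, which is nonnegative, plus the absolute value of
the sum at `h = 0`. -/
def signedSup (ψ : Z → H) (φ : Z → ℝ → ℝ) (ρ : ℝ) (z : Fin n → Z) (ε : Fin n → Bool) : ℝ :=
  (⨆ h : Metric.closedBall (0 : H) ρ,
    ∑ i, boolSign (ε i) * (φ (z i) (inner ℝ (h : H) (ψ (z i))) - φ (z i) 0)) +
  |∑ i, boolSign (ε i) * φ (z i) 0|

theorem abs_inner_le_of_norm_le (hψ : ∀ z, ‖ψ z‖ ≤ κ) {h : H} (hh : ‖h‖ ≤ ρ) (z : Z) :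
    |inner ℝ h (ψ z)| ≤ ρ * κ :=
  (abs_real_inner_le_norm _ _).trans
    (mul_le_mul hh (hψ z) (norm_nonneg _) ((norm_nonneg h).trans hh))

theorem abs_sub_apply_zero_le (hφ : ∀ z, LipschitzWith 1 (φ z)) (hψ : ∀ z, ‖ψ z‖ ≤ κ) {h : H}
    (hh : ‖h‖ ≤ ρ) (z : Z) : |φ z (inner ℝ h (ψ z)) - φ z 0| ≤ ρ * κ := by
  refine le_trans ?_ (abs_inner_le_of_norm_le hψ hh z)
  simpa [Real.dist_eq] using (hφ z).dist_le_mul (inner ℝ h (ψ z)) 0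

theorem bddAbove_signed_sum (hψ : ∀ z, ‖ψ z‖ ≤ κ) (hφ : ∀ z, LipschitzWith 1 (φ z))
    (z : Fin n → Z) (ε : Fin n → Bool) :
    BddAbove (Set.range fun h : Metric.closedBall (0 : H) ρ =>
      ∑ i, boolSign (ε i) * (φ (z i) (inner ℝ (h : H) (ψ (z i))) - φ (z i) 0)) := by
  refine ⟨∑ _i : Fin n, ρ * κ, Set.forall_mem_range.2 fun h => Finset.sum_le_sum fun i _ => ?_⟩
  refine (le_abs_self _).trans ?_
  rw [abs_mul, abs_boolSign, one_mul]
  exact abs_sub_apply_zero_le hφ hψ (mem_closedBall_zero_iff.1 h.2) _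

theorem signedSup_nonneg (hψ : ∀ z, ‖ψ z‖ ≤ κ) (hρ : 0 ≤ ρ) (hφ : ∀ z, LipschitzWith 1 (φ z))
    (z : Fin n → Z) (ε : Fin n → Bool) : 0 ≤ signedSup ψ φ ρ z ε :=
  add_nonneg (le_ciSup_of_le (bddAbove_signed_sum hψ hφ z ε) ⟨0, by simpa using hρ⟩ (by simp))
    (abs_nonneg _)

theorem signed_sum_le_signedSup (hψ : ∀ z, ‖ψ z‖ ≤ κ) (hφ : ∀ z, LipschitzWith 1 (φ z))
    (z : Fin n → Z) (ε : Fin n → Bool) {h : H} (hh : ‖h‖ ≤ ρ) :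
    ∑ i, boolSign (ε i) * φ (z i) (inner ℝ h (ψ (z i))) ≤ signedSup ψ φ ρ z ε := by
  refine le_trans (le_of_eq ?_) (add_le_add
    (le_ciSup (bddAbove_signed_sum hψ hφ z ε) ⟨h, mem_closedBall_zero_iff.2 hh⟩) (le_abs_self _))
  simp only [← Finset.sum_add_distrib, ← mul_add, sub_add_cancel]

theorem sum_signedSup_le (hκ : 0 ≤ κ) (hψ : ∀ z, ‖ψ z‖ ≤ κ) (hρ : 0 ≤ ρ)
    (hφ : ∀ z, LipschitzWith 1 (φ z)) (hL : 0 ≤ L) (hφ0 : ∀ z, |φ z 0| ≤ L) (z : Fin n → Z) :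
    ∑ ε, signedSup ψ φ ρ z ε ≤ 2 ^ n * (√n * (ρ * κ + L)) := by
  have hcentred := sum_signs_iSup_closedBall_le (ψ := fun i => ψ (z i))
    (φ := fun i t => φ (z i) t - φ (z i) 0) hκ hρ (fun i => hψ _)
    (fun i => LipschitzWith.of_dist_le_mul fun x y => by simpa using (hφ (z i)).dist_le_mul x y)
  have hzero := sum_signs_norm_le (ψ := fun i => φ (z i) 0) hL (fun i => hφ0 _)
  simp only [smul_eq_mul, Real.norm_eq_abs] at hzero
  simp only [signedSup, Finset.sum_add_distrib]
  linarith

theorem sum_supPairDev_pairSwap_le (hκ : 0 ≤ κ) (hψ : ∀ z, ‖ψ z‖ ≤ κ) (hρ : 0 < ρ)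
    (hφ : ∀ z, LipschitzWith 1 (φ z)) (hL : 0 ≤ L) (hφ0 : ∀ z, |φ z 0| ≤ L) (w : Fin n → Z × Z) :
    ∑ ε, supPairDev ψ φ ρ (pairSwap ε w) ≤ ENNReal.ofReal (2 ^ n * (2 * (√n * (ρ * κ + L)))) := by
  set z₁ : Fin n → Z := fun i => (w i).1
  set z₂ : Fin n → Z := fun i => (w i).2
  have hsup (ε : Fin n → Bool) : supPairDev ψ φ ρ (pairSwap ε w) ≤
      ENNReal.ofReal (signedSup ψ φ ρ z₂ ε + signedSup ψ φ ρ z₁ fun i => !ε i) := by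
    refine iSup_le fun c => ENNReal.ofReal_le_ofReal ?_
    have hball := norm_ballRetract_le hρ (pairComb ψ (pairSwap ε w) fun k => (c k : ℝ))
    rw [pairDev_pairSwap]
    refine le_trans (le_of_eq ?_) (add_le_add (signed_sum_le_signedSup hψ hφ z₂ ε hball)
      (signed_sum_le_signedSup hψ hφ z₁ (fun i => !ε i) hball))
    simp only [boolSign_not, ← Finset.sum_add_distrib, z₁, z₂]
    exact Finset.sum_congr rfl fun i _ => by ring
  have hnegate : ∑ ε : Fin n → Bool, signedSup ψ φ ρ z₁ (fun i => !ε i) =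
      ∑ ε : Fin n → Bool, signedSup ψ φ ρ z₁ ε :=
    (Equiv.arrowCongr (Equiv.refl (Fin n)) Equiv.boolNot).sum_comp (signedSup ψ φ ρ z₁)
  refine (Finset.sum_le_sum fun ε _ => hsup ε).trans ?_
  rw [← ENNReal.ofReal_sum_of_nonneg (fun ε _ => add_nonneg (signedSup_nonneg hψ hρ.le hφ _ _)
    (signedSup_nonneg hψ hρ.le hφ _ _)), Finset.sum_add_distrib, hnegate]
  refine ENNReal.ofReal_le_ofReal ?_
  linarith [sum_signedSup_le hκ hψ hρ.le hφ hL hφ0 z₁, sum_signedSup_le hκ hψ hρ.le hφ hL hφ0 z₂]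

section Expectation

variable [MeasurableSpace Z] (P : Measure Z) [IsProbabilityMeasure P]

theorem measurePreserving_pairSwap (ε : Fin n → Bool) :
    MeasurePreserving (pairSwap (Z := Z) ε) (Measure.pi fun _ => P.prod P)
      (Measure.pi fun _ => P.prod P) := by
  refine measurePreserving_pi (f := fun i p => if ε i then p else p.swap)
    (fun _ : Fin n => P.prod P) (fun _ => P.prod P) fun i => ?_
  cases ε i
  · simpa using Measure.measurePreserving_swap
  · exact MeasurePreserving.id _

theorem lintegral_supPairDev_le (hψm : Measurable fun p : Z × Z => inner ℝ (ψ p.1) (ψ p.2))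
    (hφm : Measurable (Function.uncurry φ)) (hκ : 0 ≤ κ) (hψ : ∀ z, ‖ψ z‖ ≤ κ) (hρ : 0 < ρ)
    (hφ : ∀ z, LipschitzWith 1 (φ z)) (hL : 0 ≤ L) (hφ0 : ∀ z, |φ z 0| ≤ L) :
    ∫⁻ w : Fin n → Z × Z, supPairDev ψ φ ρ w ∂(Measure.pi fun _ => P.prod P) ≤
      ENNReal.ofReal (2 * (√n * (ρ * κ + L))) := by
  have hm := measurable_supPairDev (n := n) hψm hφm ρ
  refine (ENNReal.mul_le_mul_iff_right (a := 2 ^ n) (by simp) (by simp)).1 ?_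
  calc (2 : ENNReal) ^ n * ∫⁻ w : Fin n → Z × Z, supPairDev ψ φ ρ w ∂(Measure.pi fun _ => P.prod P)
      = ∑ ε : Fin n → Bool, ∫⁻ w : Fin n → Z × Z, supPairDev ψ φ ρ (pairSwap ε w)
          ∂(Measure.pi fun _ => P.prod P) := by
        simp only [(measurePreserving_pairSwap P _).lintegral_comp hm, Finset.sum_const,
          Finset.card_univ, Fintype.card_fun, Fintype.card_bool, Fintype.card_fin, nsmul_eq_mul,
          Nat.cast_pow, Nat.cast_ofNat]
    _ = ∫⁻ w : Fin n → Z × Z, ∑ ε : Fin n → Bool, supPairDev ψ φ ρ (pairSwap ε w)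
          ∂(Measure.pi fun _ => P.prod P) :=
        (lintegral_finsetSum _ fun ε _ => hm.comp (measurePreserving_pairSwap P ε).measurable).symm
    _ ≤ ∫⁻ _ : Fin n → Z × Z, ENNReal.ofReal (2 ^ n * (2 * (√n * (ρ * κ + L))))
          ∂(Measure.pi fun _ => P.prod P) :=
        lintegral_mono fun w => sum_supPairDev_pairSwap_le hκ hψ hρ hφ hL hφ0 w
    _ = 2 ^ n * ENNReal.ofReal (2 * (√n * (ρ * κ + L))) := by
        rw [lintegral_const, measure_univ, mul_one, ENNReal.ofReal_mul (by positivity),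
          ENNReal.ofReal_pow zero_le_two, ENNReal.ofReal_ofNat]

end Expectation

section Integration

variable [MeasurableSpace Z] {P : Measure Z} [IsProbabilityMeasure P]

theorem measurable_inner_of_measurable_kernel [CompleteSpace H]
    (hψm : Measurable fun p : Z × Z => inner ℝ (ψ p.1) (ψ p.2)) (h : H) :
    Measurable fun z => inner ℝ h (ψ z) := by
  let M : Submodule ℝ H :=
    { carrier := {h | Measurable fun z => inner ℝ h (ψ z)}
      zero_mem' := by simp
      add_mem' := fun {a b} ha hb => by
        simp only [Set.mem_ofPred_eq, inner_add_left] at *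
        exact ha.add hb
      smul_mem' := fun c a ha => by
        simp only [Set.mem_ofPred_eq, real_inner_smul_left] at *
        exact ha.const_mul c }
  have hclosed : IsClosed (M : Set H) := IsSeqClosed.isClosed fun u a hu hua =>
    measurable_of_tendsto_metrizable hu
      (tendsto_pi_nhds.2 fun z => hua.inner tendsto_const_nhds)
  have : CompleteSpace M := hclosed.completeSpace_coe
  suffices htop : M = ⊤ from (htop ▸ Submodule.mem_top : h ∈ M)
  rw [← Submodule.orthogonal_eq_bot_iff, Submodule.eq_bot_iff]
  intro x hx
  have hfeature (z : Z) : ψ z ∈ M := hψm.comp (measurable_const.prodMk measurable_id)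
  have hxψ (z : Z) : inner ℝ x (ψ z) = 0 := Submodule.inner_left_of_mem_orthogonal (hfeature z) hx
  have hxM : x ∈ M := show Measurable fun z => inner ℝ x (ψ z) by simp only [hxψ, measurable_const]
  exact inner_self_eq_zero.1 (Submodule.inner_right_of_mem_orthogonal hxM hx)

theorem ofReal_integral_le_lintegral_ofReal {f : Z → ℝ} {μ : Measure Z} (hf : Integrable f μ) :
    ENNReal.ofReal (∫ x, f x ∂μ) ≤ ∫⁻ x, ENNReal.ofReal (f x) ∂μ := by
  refine (ENNReal.ofReal_le_ofReal
    (integral_mono hf hf.pos_part fun x => le_max_left (f x) 0)).trans_eq ?_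
  rw [ofReal_integral_eq_lintegral_ofReal hf.pos_part
    (Filter.Eventually.of_forall fun x => le_max_right _ _)]
  simp

theorem integrable_comp_inner [CompleteSpace H]
    (hψm : Measurable fun p : Z × Z => inner ℝ (ψ p.1) (ψ p.2))
    (hφm : Measurable (Function.uncurry φ)) (hψ : ∀ z, ‖ψ z‖ ≤ κ)
    (hφ : ∀ z, LipschitzWith 1 (φ z)) (hφ0 : ∀ z, |φ z 0| ≤ L) (h : H) :
    Integrable (fun z => φ z (inner ℝ h (ψ z))) P := by
  refine Integrable.of_bound (hφm.comp (measurable_id.prodMk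
    (measurable_inner_of_measurable_kernel hψm h))).aestronglyMeasurable (‖h‖ * κ + L)
    (Filter.Eventually.of_forall fun z => ?_)
  rw [Real.norm_eq_abs]
  linarith [abs_sub_abs_le_abs_sub (φ z (inner ℝ h (ψ z))) (φ z 0), hφ0 z,
    abs_sub_apply_zero_le hφ hψ le_rfl z (h := h)]

theorem integrable_pairDev {h : H} (hint : Integrable (fun z => φ z (inner ℝ h (ψ z))) P)
    (S : Fin n → Z) :
    Integrable (fun S' : Fin n → Z => pairDev ψ φ (fun i => (S i, S' i)) h)
      (Measure.pi fun _ => P) := by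
  unfold pairDev
  exact integrable_finsetSum _ fun i _ => (integrable_comp_eval (μ := fun _ : Fin n => P)
    (i := i) hint).sub (integrable_const (φ (S i) (inner ℝ h (ψ (S i)))))

theorem integral_pairDev {h : H} (hint : Integrable (fun z => φ z (inner ℝ h (ψ z))) P)
    (S : Fin n → Z) :
    ∫ S' : Fin n → Z, pairDev ψ φ (fun i => (S i, S' i)) h ∂(Measure.pi fun _ => P) =
      n * ∫ z, φ z (inner ℝ h (ψ z)) ∂P - ∑ i, φ (S i) (inner ℝ h (ψ (S i))) := by
  have hcoord (i : Fin n) : Integrable (fun S' : Fin n → Z => φ (S' i) (inner ℝ h (ψ (S' i))))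
      (Measure.pi fun _ => P) := integrable_comp_eval (μ := fun _ : Fin n => P) (i := i) hint
  have heval (i : Fin n) : ∫ S' : Fin n → Z, φ (S' i) (inner ℝ h (ψ (S' i)))
      ∂(Measure.pi fun _ => P) = ∫ z, φ z (inner ℝ h (ψ z)) ∂P :=
    integral_comp_eval (μ := fun _ : Fin n => P) (i := i) hint.aestronglyMeasurable
  simp only [pairDev, Finset.sum_sub_distrib]
  rw [integral_sub (integrable_finsetSum _ fun i _ => hcoord i) (integrable_const _),
    integral_finsetSum _ fun i _ => hcoord i]
  simp [heval]

/-- Symmetrization: the bound is the expectation of `supPairDev` over the ghost sample. -/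
theorem exists_uniform_deviation [CompleteSpace H]
    (hψm : Measurable fun p : Z × Z => inner ℝ (ψ p.1) (ψ p.2))
    (hφm : Measurable (Function.uncurry φ)) (hκ : 0 ≤ κ) (hψ : ∀ z, ‖ψ z‖ ≤ κ) (hρ : 0 < ρ)
    (hφ : ∀ z, LipschitzWith 1 (φ z)) (hL : 0 ≤ L) (hφ0 : ∀ z, |φ z 0| ≤ L) (n : ℕ) :
    ∃ Φ : (Fin n → Z) → ENNReal, Measurable Φ ∧
      ∫⁻ S, Φ S ∂(Measure.pi fun _ => P) ≤ ENNReal.ofReal (2 * (√n * (ρ * κ + L))) ∧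
      ∀ S, ∀ h : H, ‖h‖ ≤ ρ → ENNReal.ofReal (n * ∫ z, φ z (inner ℝ h (ψ z)) ∂P -
        ∑ i, φ (S i) (inner ℝ h (ψ (S i)))) ≤ Φ S := by
  have hpair := (measurePreserving_arrowProdEquivProdArrow Z Z (Fin n) (fun _ => P)
    fun _ => P).symm
  have hm := measurable_supPairDev (n := n) hψm hφm ρ
  have hmpair : Measurable fun p : (Fin n → Z) × (Fin n → Z) =>
      supPairDev ψ φ ρ fun i => (p.1 i, p.2 i) := hm.comp hpair.measurable
  refine ⟨fun S => ∫⁻ S', supPairDev ψ φ ρ (fun i => (S i, S' i)) ∂(Measure.pi fun _ => P),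
    hmpair.lintegral_prod_right', ?_, fun S h hh => ?_⟩
  · rw [← lintegral_prod _ hmpair.aemeasurable]
    exact (hpair.lintegral_comp hm).trans_le (lintegral_supPairDev_le P hψm hφm hκ hψ hρ hφ hL hφ0)
  · have hint := integrable_comp_inner (P := P) hψm hφm hψ hφ hφ0 h
    rw [← integral_pairDev hint]
    exact (ofReal_integral_le_lintegral_ofReal (integrable_pairDev hint S)).trans
      (lintegral_mono fun S' =>
        ofReal_pairDev_le_supPairDev hρ (fun z => (hφ z).continuous) _ hh)

end Integration

end Deviation

section Ridge

theorem norm_le_of_ridge_minimizer {H : Type*} [NormedAddCommGroup H] {E : H → ℝ} {lam L₀ : ℝ}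
    (hlam : 0 < lam) (hnonneg : ∀ h, 0 ≤ E h) (hzero : E 0 ≤ L₀) {h : H}
    (hh : ∀ g, E h + lam / 2 * ‖h‖ ^ 2 ≤ E g + lam / 2 * ‖g‖ ^ 2) : ‖h‖ ≤ √(2 * L₀) / √lam := by
  rw [← Real.sqrt_div' _ hlam.le]
  refine Real.le_sqrt_of_sq_le ((le_div_iff₀ hlam).2 ?_)
  have hcompare := hh 0
  rw [norm_zero] at hcompare
  linarith [hnonneg h]

open Filter Topology in
theorem existsUnique_forall_le_of_dist_le {X : Type*} [MetricSpace X] [CompleteSpace X]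
    [Nonempty X] {F : X → ℝ} (hF : Continuous F) (hbdd : BddBelow (Set.range F)) {ω : ℝ → ℝ}
    (hω : Tendsto ω (𝓝[>] 0) (𝓝 0))
    (hdist : ∀ η > 0, ∀ x y, F x ≤ (⨅ z, F z) + η → F y ≤ (⨅ z, F z) + η → dist x y ≤ ω η) :
    ∃! x, ∀ y, F x ≤ F y := by
  set d := ⨅ z, F z
  have hpos (k : ℕ) : 0 < 1 / ((k : ℝ) + 1) := by positivity
  have hexists (k : ℕ) : ∃ x, F x ≤ d + 1 / ((k : ℝ) + 1) :=
    (exists_lt_of_ciInf_lt (lt_add_of_pos_right d (hpos k))).imp fun _ => le_of_lt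
  choose x hx using hexists
  have hωseq : Tendsto (fun k : ℕ => ω (1 / ((k : ℝ) + 1))) atTop (𝓝 0) :=
    hω.comp (tendsto_nhdsWithin_iff.2
      ⟨tendsto_one_div_add_atTop_nhds_zero_nat, Eventually.of_forall hpos⟩)
  have hcauchy : CauchySeq x := by
    refine cauchySeq_of_le_tendsto_0 _ (fun i j N hi hj => ?_) hωseq
    have hmono {i : ℕ} (hi : N ≤ i) : F (x i) ≤ d + 1 / ((N : ℝ) + 1) := (hx i).trans (by gcongr)
    exact hdist _ (hpos N) _ _ (hmono hi) (hmono hj)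
  obtain ⟨y, hy⟩ := cauchySeq_tendsto_of_complete hcauchy
  have hmin : F y ≤ d := le_of_tendsto_of_tendsto' ((hF.tendsto y).comp hy)
    (by simpa using tendsto_one_div_add_atTop_nhds_zero_nat.const_add d) hx
  refine ⟨y, fun z => hmin.trans (ciInf_le hbdd z), fun z hz => dist_le_zero.1 ?_⟩
  refine ge_of_tendsto' hωseq fun k => hdist _ (hpos k) z y ?_ ?_ <;>
    linarith [hz y, hpos k]

variable {H : Type*} [NormedAddCommGroup H] [InnerProductSpace ℝ H] {E : H → ℝ} {lam : ℝ}

theorem norm_midpoint_sq (g h : H) :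
    ‖(1 / 2 : ℝ) • (g + h)‖ ^ 2 = (‖g‖ ^ 2 + ‖h‖ ^ 2) / 2 - ‖g - h‖ ^ 2 / 4 := by
  rw [norm_smul, mul_pow]
  norm_num
  linarith [parallelogram_law_with_norm ℝ g h]

theorem norm_sub_sq_le_of_near_min {d η : ℝ} (hlam : 0 < lam)
    (hmid : ∀ g h, E ((1 / 2 : ℝ) • (g + h)) ≤ (E g + E h) / 2)
    (hd : ∀ g, d ≤ E g + lam / 2 * ‖g‖ ^ 2) {g h : H} (hg : E g + lam / 2 * ‖g‖ ^ 2 ≤ d + η)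
    (hh : E h + lam / 2 * ‖h‖ ^ 2 ≤ d + η) : ‖g - h‖ ^ 2 ≤ 8 / lam * η := by
  have hmin := hd ((1 / 2 : ℝ) • (g + h))
  rw [norm_midpoint_sq] at hmin
  rw [div_mul_eq_mul_div, le_div_iff₀ hlam]
  linarith [hmid g h]

open Filter Topology in
theorem existsUnique_ridge_minimizer [CompleteSpace H] (hlam : 0 < lam) (hE : Continuous E)
    (hnonneg : ∀ h, 0 ≤ E h) (hmid : ∀ g h, E ((1 / 2 : ℝ) • (g + h)) ≤ (E g + E h) / 2) :
    ∃! h, ∀ g, E h + lam / 2 * ‖h‖ ^ 2 ≤ E g + lam / 2 * ‖g‖ ^ 2 := by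
  have hbdd : BddBelow (Set.range fun g => E g + lam / 2 * ‖g‖ ^ 2) :=
    ⟨0, Set.forall_mem_range.2 fun g => add_nonneg (hnonneg g) (by positivity)⟩
  have hω : Tendsto (fun η => √(8 / lam * η)) (𝓝[>] 0) (𝓝 0) := by
    have hcont : Continuous fun η => √(8 / lam * η) := by fun_prop
    simpa using (hcont.tendsto 0).mono_left nhdsWithin_le_nhds
  refine existsUnique_forall_le_of_dist_le (by fun_prop) hbdd hω fun η _ g h hg hh => ?_
  rw [dist_eq_norm]
  exact Real.le_sqrt_of_sq_le (norm_sub_sq_le_of_near_min hlam hmid (ciInf_le hbdd) hg hh)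

theorem neg_inner_le_of_ridge_minimizer {C : ℝ} (hlam : 0 < lam) {h : H}
    (hh : ∀ g, E h + lam / 2 * ‖h‖ ^ 2 ≤ E g + lam / 2 * ‖g‖ ^ 2) {g : H}
    (hg : ∀ t : ℝ, 0 < t → E (h + t • g) - E h ≤ t * C) : -(lam * inner ℝ h g) ≤ C := by
  refine le_of_forall_pos_le_add fun η hη => ?_
  obtain ⟨t, ht, htη⟩ : ∃ t > 0, t * (lam * (‖g‖ ^ 2 + 1)) = η :=
    ⟨η / (lam * (‖g‖ ^ 2 + 1)), by positivity, div_mul_cancel₀ _ (by positivity)⟩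
  have hcompare := hh (h + t • g)
  rw [norm_add_sq_real, real_inner_smul_right, norm_smul, mul_pow, Real.norm_eq_abs, sq_abs]
    at hcompare
  have hfirst : t * -(lam * inner ℝ h g) ≤ t * (C + lam / 2 * t * ‖g‖ ^ 2) := by
    linarith [hg t ht]
  have hquadratic : 0 ≤ lam / 2 * t * ‖g‖ ^ 2 := by positivity
  linarith [le_of_mul_le_mul_left hfirst ht, mul_pos ht hlam, hquadratic]

theorem abs_inner_le_of_ridge_minimizer {C : ℝ} (hlam : 0 < lam) {h : H}
    (hh : ∀ g, E h + lam / 2 * ‖h‖ ^ 2 ≤ E g + lam / 2 * ‖g‖ ^ 2) {g : H}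
    (hg : ∀ t : ℝ, E (h + t • g) - E h ≤ |t| * C) : |inner ℝ h g| ≤ C / lam := by
  have hlower := neg_inner_le_of_ridge_minimizer (C := C) hlam hh (g := g) fun t ht => by
    simpa [abs_of_pos ht] using hg t
  have hupper := neg_inner_le_of_ridge_minimizer (C := C) hlam hh (g := -g) fun t ht => by
    simpa [abs_of_pos ht] using hg (-t)
  rw [inner_neg_right] at hupper
  rw [le_div_iff₀ hlam, mul_comm]
  calc lam * |inner ℝ h g| = |lam * inner ℝ h g| := by rw [abs_mul, abs_of_pos hlam]
    _ ≤ C := abs_le.2 ⟨by linarith, by linarith⟩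

end Ridge

section Loss

variable {τ : Task} {θ θ' y s t B b : ℝ}

theorem Task.hi_sub_lo_le (τ : Task) : τ.hi - τ.lo ≤ 2 := by
  cases τ <;> norm_num [Task.lo, Task.hi]

theorem abs_le_one_of_mem_Icc_lo_hi (hθ : θ ∈ Set.Icc τ.lo τ.hi) : |θ| ≤ 1 := by
  cases τ <;> simp only [Task.lo, Task.hi] at hθ <;> exact abs_le.2 ⟨by linarith [hθ.1], hθ.2⟩

theorem abs_add_mul_le {a b c d e : ℝ} (ha : |a| ≤ b) (hc : |c| ≤ 1) (hd : |d| ≤ e) :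
    |a + c * d| ≤ b + e := calc
  |a + c * d| ≤ |a| + |c| * |d| := abs_mul c d ▸ abs_add_le _ _
  _ ≤ b + 1 * e := by gcongr
  _ = b + e := by rw [one_mul]

theorem loss_nonneg (hθ : θ ∈ Set.Icc τ.lo τ.hi) (y t : ℝ) : 0 ≤ τ.loss θ y t := by
  cases τ
  · rcases le_total 0 (y - t) with h | h
    · exact le_max_of_le_left (mul_nonneg hθ.1 h)
    · exact le_max_of_le_right (mul_nonneg_of_nonpos_of_nonpos (sub_nonpos.2 hθ.2) h)
  · exact mul_nonneg (abs_nonneg _) (le_max_right _ _)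

theorem loss_midpoint_le (θ y s t : ℝ) :
    τ.loss θ y ((s + t) / 2) ≤ (τ.loss θ y s + τ.loss θ y t) / 2 := by
  have hmax (a b c d : ℝ) : max ((a + b) / 2) ((c + d) / 2) ≤ (max a c + max b d) / 2 :=
    max_le (by gcongr <;> exact le_max_left _ _) (by gcongr <;> exact le_max_right _ _)
  cases τ <;> simp only [Task.loss]
  · convert hmax (θ * (y - s)) (θ * (y - t)) ((θ - 1) * (y - s)) ((θ - 1) * (y - t)) using 2 <;>
      ring
  · rw [← mul_add, mul_div_assoc]
    gcongr
    have h := hmax (1 - y * s) (1 - y * t) 0 0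
    rwa [add_zero, zero_div, show (1 - y * s + (1 - y * t)) / 2 = 1 - y * ((s + t) / 2) by ring]
      at h

theorem continuous_loss (θ y : ℝ) : Continuous (τ.loss θ y) := by
  cases τ
  · change Continuous fun t => max (θ * (y - t)) ((θ - 1) * (y - t))
    fun_prop
  · change Continuous fun t =>
      |(θ + 1) / 2 - Set.indicator {(-1 : ℝ)} (fun _ => 1) y| * max (1 - y * t) 0
    fun_prop

theorem measurable_loss (θ : ℝ) : Measurable fun p : ℝ × ℝ => τ.loss θ p.1 p.2 := by
  cases τ
  · simp only [Task.loss]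
    fun_prop
  · have hindicator : Measurable fun p : ℝ × ℝ =>
        Set.indicator {(-1 : ℝ)} (fun _ => (1 : ℝ)) p.1 :=
      (measurable_const.indicator (measurableSet_singleton _)).comp measurable_fst
    simp only [Task.loss]
    fun_prop

theorem measurableSet_outputs (τ : Task) (B : ℝ) : MeasurableSet (τ.outputs B) := by
  cases τ
  · exact measurableSet_Icc
  · exact (Set.toFinite ({-1, 1} : Set ℝ)).measurableSet

theorem loss_costSensitive (hy : y ∈ Task.costSensitive.outputs B)
    (hθ : θ ∈ Set.Icc Task.costSensitive.lo Task.costSensitive.hi) (t : ℝ) :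
    Task.costSensitive.loss θ y t = max ((1 / 2 + y / 2 * θ) * (1 + -y * t)) 0 := by
  simp only [Task.lo, Task.hi] at hθ
  have hweight : 0 ≤ 1 / 2 + y / 2 * θ ∧
      |(θ + 1) / 2 - Set.indicator {(-1 : ℝ)} (fun _ => 1) y| = 1 / 2 + y / 2 * θ := by
    rcases hy with rfl | rfl
    · refine ⟨by linarith [hθ.2], ?_⟩
      rw [Set.indicator_of_mem (Set.mem_singleton _), abs_of_nonpos (by linarith [hθ.2])]
      ring
    · refine ⟨by linarith [hθ.1], ?_⟩
      rw [Set.indicator_of_notMem (by norm_num), abs_of_nonneg (by linarith [hθ.1])]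
      ring
  rw [Task.loss, hweight.2, mul_max_of_nonneg _ _ hweight.1, mul_zero, neg_mul, ← sub_eq_add_neg]

/-- A product of an affine function of `θ` and an affine function of `t`, with coefficients at most
`1` except for the constant term of the second factor, which is at most `b`. The two tasks have a
common expression for their losses in terms of such products. -/
def IsBoundedBiaffine (b : ℝ) (g : ℝ → ℝ → ℝ) : Prop :=
  ∃ α β c d : ℝ, |α| ≤ 1 ∧ |β| ≤ 1 ∧ |c| ≤ b ∧ |d| ≤ 1 ∧
    ∀ θ t, g θ t = (α + β * θ) * (c + d * t)

theorem exists_loss_eq_biaffine_add_posPart (hy : y ∈ τ.outputs B) :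
    ∃ g₁ g₂ : ℝ → ℝ → ℝ, IsBoundedBiaffine (|B| + 1) g₁ ∧ IsBoundedBiaffine (|B| + 1) g₂ ∧
      ∀ θ ∈ Set.Icc τ.lo τ.hi, ∀ t, τ.loss θ y t = g₁ θ t + max (g₂ θ t) 0 := by
  have hB := abs_nonneg B
  cases τ
  · have hyB : |y| ≤ |B| + 1 := by linarith [(abs_le.2 hy).trans (le_abs_self B)]
    refine ⟨fun θ t => (0 + 1 * θ) * (y + -1 * t), fun θ t => (1 + 0 * θ) * (-y + 1 * t),
      ⟨0, 1, y, -1, by simpa using hyB⟩, ⟨1, 0, -y, 1, by simpa using hyB⟩, fun θ _ t => ?_⟩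
    rw [Task.loss, ← max_add_add_left, max_comm]
    congr 1 <;> ring
  · have hy1 : |y| = 1 := by rcases hy with rfl | rfl <;> simp
    have hhalf : |y / 2| ≤ 1 := by rw [abs_div, hy1]; norm_num
    refine ⟨fun θ t => (0 + 0 * θ) * (0 + 0 * t), fun θ t => (1 / 2 + y / 2 * θ) * (1 + -y * t),
      ⟨0, 0, 0, 0, by simp; linarith⟩,
      ⟨1 / 2, y / 2, 1, -y, by norm_num [abs_of_pos], hhalf, by simp,
        by rw [abs_neg, hy1], fun _ _ => rfl⟩, fun θ hθ t => ?_⟩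
    simp [loss_costSensitive hy hθ]

theorem lipschitzWith_loss (hy : y ∈ τ.outputs B) (hθ : θ ∈ Set.Icc τ.lo τ.hi) :
    LipschitzWith 1 (τ.loss θ y) := by
  refine LipschitzWith.of_dist_le_mul fun s t => ?_
  rw [NNReal.coe_one, one_mul, Real.dist_eq, Real.dist_eq]
  cases τ
  · simp only [Task.loss, Task.lo, Task.hi] at *
    have hdiff : y - s - (y - t) = -(s - t) := by ring
    refine (abs_max_sub_max_le_max _ _ _ _).trans (max_le ?_ ?_) <;>
      rw [← mul_sub, abs_mul, hdiff, abs_neg] <;>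
      exact mul_le_of_le_one_left (abs_nonneg _) (abs_le.2 ⟨by linarith [hθ.1], by linarith [hθ.2]⟩)
  · rw [loss_costSensitive hy hθ, loss_costSensitive hy hθ]
    have hy1 : |y| = 1 := by rcases hy with rfl | rfl <;> simp
    have hweight : |1 / 2 + y / 2 * θ| ≤ 1 := by
      refine (abs_add_le _ _).trans ?_
      rw [abs_mul, abs_div, abs_div, hy1]
      norm_num
      linarith [abs_le_one_of_mem_Icc_lo_hi hθ]
    refine (abs_max_sub_max_le_abs _ _ _).trans ?_
    rw [← mul_sub, abs_mul, add_sub_add_left_eq_sub, ← mul_sub, abs_mul, abs_neg, hy1, one_mul]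
    exact mul_le_of_le_one_left (abs_nonneg _) hweight

theorem loss_zero_le (hy : y ∈ τ.outputs B) (hθ : θ ∈ Set.Icc τ.lo τ.hi) :
    τ.loss θ y 0 ≤ |B| + 1 := by
  have hB := abs_nonneg B
  cases τ
  · simp only [Task.loss, Task.lo, Task.hi, sub_zero] at *
    have hyB : |y| ≤ |B| := (abs_le.2 hy).trans (le_abs_self B)
    have hbound (r : ℝ) (hr : |r| ≤ 1) : r * y ≤ |B| + 1 := by
      have hmul : |r * y| ≤ 1 * |B| := abs_mul r y ▸ mul_le_mul hr hyB (abs_nonneg _) zero_le_one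
      linarith [le_abs_self (r * y)]
    exact max_le (hbound θ (abs_le.2 ⟨by linarith [hθ.1], hθ.2⟩))
      (hbound (θ - 1) (abs_le.2 ⟨by linarith [hθ.1], by linarith [hθ.2]⟩))
  · rw [loss_costSensitive hy hθ]
    have hθ1 := abs_le.1 (abs_le_one_of_mem_Icc_lo_hi hθ)
    refine max_le ?_ (by positivity)
    rcases hy with rfl | rfl <;> linarith [hθ1.1, hθ1.2]

theorem loss_le (hy : y ∈ τ.outputs B) (hθ : θ ∈ Set.Icc τ.lo τ.hi) :
    τ.loss θ y t ≤ |B| + 1 + |t| := by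
  have h := (lipschitzWith_loss hy hθ).dist_le_mul t 0
  rw [NNReal.coe_one, one_mul, Real.dist_eq, Real.dist_eq, sub_zero] at h
  linarith [le_abs_self (τ.loss θ y t - τ.loss θ y 0), loss_zero_le hy hθ]

namespace IsBoundedBiaffine

variable {g : ℝ → ℝ → ℝ} {F L : ℝ}

theorem abs_sub_le (hg : IsBoundedBiaffine b g) (hθ : |θ| ≤ 1) (ht : |t| ≤ F)
    (hst : |s - t| ≤ L * |θ - θ'|) : |g θ s - g θ' t| ≤ (2 * L + b + F) * |θ - θ'| := by
  obtain ⟨α, β, c, d, hα, hβ, hc, hd, hg⟩ := hg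
  have hfirst : |α + β * θ| ≤ 1 + 1 := abs_add_mul_le hα hβ hθ
  have hsecond : |c + d * t| ≤ b + F := abs_add_mul_le hc hd ht
  calc |g θ s - g θ' t| = |(α + β * θ) * d * (s - t) + β * (c + d * t) * (θ - θ')| := by
        rw [hg, hg]; ring_nf
    _ ≤ |α + β * θ| * |d| * |s - t| + |β| * |c + d * t| * |θ - θ'| := by
        simpa only [abs_mul] using
          abs_add_le ((α + β * θ) * d * (s - t)) (β * (c + d * t) * (θ - θ'))
    _ ≤ (1 + 1) * 1 * (L * |θ - θ'|) + 1 * (b + F) * |θ - θ'| := by gcongr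
    _ = (2 * L + b + F) * |θ - θ'| := by ring

/-- The term `(2 * q + ε) * δ` accounts for the variation of the two factors of `g` on the set. -/
theorem exists_chordSlopesNear (hg : IsBoundedBiaffine b g) {Q v : ℝ → ℝ} {ℓ p q ε δ x₀ : ℝ}
    {S : Set ℝ} (hℓ : |ℓ| ≤ 2) (hQ1 : ∀ x ∈ S, |Q x| ≤ 1) (hQ : ChordSlopesNear Q ℓ 0 S)
    (hε : 0 ≤ ε) (hx₀ : x₀ ∈ S) (hδ : ∀ x ∈ S, |x - x₀| ≤ δ) (hvF : |v x₀| ≤ F) (hp : |p| ≤ q)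
    (hv : ChordSlopesNear v p ε S) :
    ∃ p', |p'| ≤ 2 * (q + b + F) ∧
      ChordSlopesNear (fun x => g (Q x) (v x)) p' (2 * (ε + (2 * q + ε) * δ)) S := by
  obtain ⟨α, β, c, d, hα, hβ, hc, hd, hg⟩ := hg
  have hfirst (x) (hx : x ∈ S) : |α + β * Q x| ≤ 1 + 1 := abs_add_mul_le hα hβ (hQ1 x hx)
  have hsecond : |c + d * v x₀| ≤ b + F := abs_add_mul_le hc hd hvF
  refine ⟨(α + β * Q x₀) * d * p + β * ℓ * (c + d * v x₀), ?_, fun x hx y hy => ?_⟩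
  · calc _ ≤ |(α + β * Q x₀) * d * p| + |β * ℓ * (c + d * v x₀)| := abs_add_le _ _
      _ = |α + β * Q x₀| * |d| * |p| + |β| * |ℓ| * |c + d * v x₀| := by simp only [abs_mul]
      _ ≤ (1 + 1) * 1 * q + 1 * 2 * (b + F) := by gcongr; exact hfirst x₀ hx₀
      _ = 2 * (q + b + F) := by ring
  have hQsub (x y) (hx : x ∈ S) (hy : y ∈ S) : Q x - Q y = ℓ * (x - y) := by
    simpa [sub_eq_zero] using hQ x hx y hy
  have hQx : |Q x - Q x₀| ≤ 2 * δ := by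
    rw [hQsub x x₀ hx hx₀, abs_mul]
    gcongr
    exact hδ x hx
  have hvy : |v y - v x₀| ≤ (q + ε) * δ := calc
    |v y - v x₀| ≤ (|p| + ε) * |y - x₀| := hv.abs_sub_le hy hx₀
    _ ≤ (q + ε) * δ := by gcongr; exacts [by linarith [abs_nonneg p], hδ y hy]
  calc _ = |(α + β * Q x) * d * (v x - v y - p * (x - y)) +
        β * d * (Q x - Q x₀) * p * (x - y) + β * d * ℓ * (v y - v x₀) * (x - y)| := by
        simp only [hg]
        congr 1
        linear_combination
          β * (c + d * v y) * hQsub x y hx hy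
    _ ≤ |(α + β * Q x) * d * (v x - v y - p * (x - y))| + |β * d * (Q x - Q x₀) * p * (x - y)| +
        |β * d * ℓ * (v y - v x₀) * (x - y)| := abs_add_three _ _ _
    _ = |α + β * Q x| * |d| * |v x - v y - p * (x - y)| +
        |β| * |d| * |Q x - Q x₀| * |p| * |x - y| +
        |β| * |d| * |ℓ| * |v y - v x₀| * |x - y| := by simp only [abs_mul]
    _ ≤ (1 + 1) * 1 * (ε * |x - y|) + 1 * 1 * (2 * δ) * q * |x - y| +
        1 * 1 * 2 * ((q + ε) * δ) * |x - y| := by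
        gcongr
        · exact hfirst x hx
        · exact hv x hx y hy
        · linarith [(abs_nonneg _).trans hQx]
    _ = 2 * (ε + (2 * q + ε) * δ) * |x - y| := by ring

end IsBoundedBiaffine

theorem abs_loss_sub_loss_le {F L : ℝ} (hy : y ∈ τ.outputs B) (hθ : θ ∈ Set.Icc τ.lo τ.hi)
    (hθ' : θ' ∈ Set.Icc τ.lo τ.hi) (ht : |t| ≤ F) (hst : |s - t| ≤ L * |θ - θ'|) :
    |τ.loss θ y s - τ.loss θ' y t| ≤ 2 * (2 * L + (|B| + 1) + F) * |θ - θ'| := by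
  obtain ⟨g₁, g₂, hg₁, hg₂, hloss⟩ := exists_loss_eq_biaffine_add_posPart hy
  have hθ1 := abs_le_one_of_mem_Icc_lo_hi hθ
  rw [hloss θ hθ, hloss θ' hθ', add_sub_add_comm]
  calc _ ≤ |g₁ θ s - g₁ θ' t| + |g₂ θ s - g₂ θ' t| :=
        (abs_add_le _ _).trans (add_le_add_right (abs_max_sub_max_le_abs _ _ _) _)
    _ ≤ (2 * L + (|B| + 1) + F) * |θ - θ'| + (2 * L + (|B| + 1) + F) * |θ - θ'| :=
        add_le_add (hg₁.abs_sub_le hθ1 ht hst) (hg₂.abs_sub_le hθ1 ht hst)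
    _ = _ := by ring

end Loss

section KernelSlopes

theorem chordSlopesNear_of_hasDerivWithinAt {f f' : ℝ → ℝ} {s : Set ℝ} {p ε : ℝ}
    (hs : Convex ℝ s) (hf : ∀ x ∈ s, HasDerivWithinAt f (f' x) s x)
    (hf' : ∀ x ∈ s, |f' x - p| ≤ ε) : ChordSlopesNear f p ε s := fun x hx y hy => by
  have h := hs.norm_image_sub_le_of_norm_hasDerivWithin_le (f := fun r => f r - p * r)
    (fun r hr => (hf r hr).sub ((hasDerivWithinAt_id r s).const_mul p))
    (fun r hr => (mul_one p).symm ▸ hf' r hr) hy hx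
  rw [Real.norm_eq_abs, Real.norm_eq_abs] at h
  convert h using 2
  ring

theorem ChordSlopesNear.abs_slope_sub_le {f : ℝ → ℝ} {s : Set ℝ} {p ε a b : ℝ}
    (hf : ChordSlopesNear f p ε s) (ha : a ∈ s) (hb : b ∈ s) (hab : a ≠ b) :
    |slope f a b - p| ≤ ε := by
  have hne : b - a ≠ 0 := sub_ne_zero.2 hab.symm
  have hdiff : slope f a b - p = (f b - f a - p * (b - a)) / (b - a) := by
    rw [slope_def_field]
    field_simp
  rw [hdiff, abs_div, div_le_iff₀ (abs_pos.2 hne)]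
  exact hf b hb a ha

theorem ChordSlopesNear.slope {f : ℝ → ℝ} {s : Set ℝ} {p ε a b : ℝ}
    (hf : ChordSlopesNear f p ε s) (ha : a ∈ s) (hb : b ∈ s) (hab : a ≠ b) :
    ChordSlopesNear f (slope f a b) (2 * ε) s := fun x hx y hy => by
  have hsplit : f x - f y - _root_.slope f a b * (x - y) =
      (f x - f y - p * (x - y)) - (_root_.slope f a b - p) * (x - y) := by ring
  calc |f x - f y - _root_.slope f a b * (x - y)|
      ≤ |f x - f y - p * (x - y)| + |_root_.slope f a b - p| * |x - y| := by
        rw [hsplit, ← abs_mul]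
        exact abs_sub _ _
    _ ≤ ε * |x - y| + ε * |x - y| :=
        add_le_add (hf x hx y hy) (by gcongr; exact hf.abs_slope_sub_le ha hb hab)
    _ = 2 * ε * |x - y| := by ring

variable {k : ℝ → ℝ → ℝ} {I J : Set ℝ}

theorem exists_continuousOn_hasDerivWithinAt_fst (hI : UniqueDiffOn ℝ I) (hJ : UniqueDiffOn ℝ J)
    (hk : ContDiffOn ℝ 1 (Function.uncurry k) (I ×ˢ J)) :
    ∃ k' : ℝ × ℝ → ℝ, ContinuousOn k' (I ×ˢ J) ∧
      ∀ s ∈ I, ∀ θ ∈ J, HasDerivWithinAt (fun r => k r θ) (k' (s, θ)) I s := by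
  refine ⟨fun p => fderivWithin ℝ (Function.uncurry k) (I ×ˢ J) p (1, 0),
    (hk.continuousOn_fderivWithin (hI.prod hJ) le_rfl).clm_apply continuousOn_const,
    fun s hs θ hθ => ?_⟩
  have hpartial : HasDerivWithinAt (fun r : ℝ => (r, θ)) (1, 0) I s :=
    (hasDerivWithinAt_id s I).prodMk (hasDerivWithinAt_const s I θ)
  have htotal := (hk.differentiableOn one_ne_zero (s, θ) ⟨hs, hθ⟩).hasFDerivWithinAt
  exact htotal.comp_hasDerivWithinAt s hpartial fun r hr => Set.mk_mem_prod hr hθ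

theorem exists_lipschitz_fst (hI : UniqueDiffOn ℝ I) (hJ : UniqueDiffOn ℝ J) (hIc : IsCompact I)
    (hJc : IsCompact J) (hIconvex : Convex ℝ I)
    (hk : ContDiffOn ℝ 1 (Function.uncurry k) (I ×ˢ J)) :
    ∃ K, 0 ≤ K ∧ ∀ θ ∈ J, ChordSlopesNear (fun r => k r θ) 0 K I := by
  obtain ⟨k', hk'c, hk'⟩ := exists_continuousOn_hasDerivWithinAt_fst hI hJ hk
  obtain ⟨K, hK⟩ := (hIc.prod hJc).exists_bound_of_continuousOn hk'c
  refine ⟨max K 0, le_max_right _ _, fun θ hθ => chordSlopesNear_of_hasDerivWithinAt hIconvex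
    (fun s hs => hk' s hs θ hθ) fun s hs => ?_⟩
  rw [sub_zero]
  exact (hK (s, θ) ⟨hs, hθ⟩).trans (le_max_left _ _)

theorem eventually_chordSlopesNear_dyadicCell (hJ : UniqueDiffOn ℝ J) (hJc : IsCompact J)
    (hk : ContDiffOn ℝ 1 (Function.uncurry k) (Set.Icc 0 1 ×ˢ J)) {ε : ℝ} (hε : 0 < ε) :
    ∀ᶠ l : ℕ in Filter.atTop, ∀ i : ℕ, i < 2 ^ l → ∀ θ ∈ J,
      ChordSlopesNear (fun r => k r θ) (slope (fun r => k r θ) (i / 2 ^ l) ((i + 1) / 2 ^ l)) ε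
        (dyadicCell l i) := by
  obtain ⟨k', hk'c, hk'⟩ := exists_continuousOn_hasDerivWithinAt_fst
    (uniqueDiffOn_Icc zero_lt_one) hJ hk
  obtain ⟨η, hη, hunif⟩ := Metric.uniformContinuousOn_iff.1
    ((isCompact_Icc.prod hJc).uniformContinuousOn_of_continuous hk'c) (ε / 2) (half_pos hε)
  have hmesh : ∀ᶠ l : ℕ in Filter.atTop, (1 / 2 : ℝ) ^ l < η :=
    (tendsto_pow_atTop_nhds_zero_of_lt_one (by norm_num) (by norm_num)).eventually_lt_const hη
  filter_upwards [hmesh] with l hl i hi θ hθ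
  have hsub := dyadicCell_subset_Icc hi
  have hleft := left_mem_dyadicCell l i
  have hnear : ChordSlopesNear (fun r => k r θ) (k' (i / 2 ^ l, θ)) (ε / 2) (dyadicCell l i) := by
    refine chordSlopesNear_of_hasDerivWithinAt (convex_Icc _ _)
      (fun s hs => (hk' s (hsub hs) θ hθ).mono hsub) fun s hs => ?_
    refine (hunif (s, θ) ⟨hsub hs, hθ⟩ (_, θ) ⟨hsub hleft, hθ⟩ ?_).le
    rw [Prod.dist_eq, dist_self, Real.dist_eq]
    exact max_lt ((abs_sub_left_le_of_mem_dyadicCell hs).trans_lt hl) hη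
  have hne : (i / 2 ^ l : ℝ) ≠ (i + 1) / 2 ^ l := by
    rw [Ne, div_left_inj' (by positivity)]
    simp
  have h := hnear.slope hleft (right_mem_dyadicCell l i) hne
  rwa [mul_div_cancel₀ ε two_ne_zero] at h

end KernelSlopes

section Kernel

variable {X V H : Type*} [NormedAddCommGroup V] [InnerProductSpace ℝ V] [CompleteSpace V]
  [NormedAddCommGroup H] [InnerProductSpace ℝ H] [CompleteSpace H] [RKHS ℝ H X V]
  {k : X → X → ℝ} {κ : ℝ}

theorem kerFun_eq_smul (hk : ∀ x z, RKHS.kernel H x z = k x z • ContinuousLinearMap.id ℝ V)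
    (x z : X) (v : V) : RKHS.kerFun H z v x = k x z • v := by
  rw [RKHS.kerFun_apply, hk, smul_apply, ContinuousLinearMap.id_apply]

theorem inner_kerFun_kerFun
    (hk : ∀ x z, RKHS.kernel H x z = k x z • ContinuousLinearMap.id ℝ V) (x z : X) (v : V) :
    inner ℝ (RKHS.kerFun H x v) (RKHS.kerFun H z v) = k x z * ‖v‖ ^ 2 := by
  rw [RKHS.kerFun_inner, kerFun_eq_smul hk, real_inner_smul_right, real_inner_self_eq_norm_sq]

theorem norm_kerFun_le (hk : ∀ x z, RKHS.kernel H x z = k x z • ContinuousLinearMap.id ℝ V)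
    {x : X} (hκ : k x x ≤ κ ^ 2) : ‖RKHS.kerFun H x‖ ≤ |κ| := by
  refine ContinuousLinearMap.opNorm_le_bound _ (abs_nonneg κ) fun v =>
    le_of_sq_le_sq ?_ (by positivity)
  rw [← real_inner_self_eq_norm_sq, inner_kerFun_kerFun hk, mul_pow, sq_abs]
  gcongr

theorem norm_apply_le_mul_norm
    (hk : ∀ x z, RKHS.kernel H x z = k x z • ContinuousLinearMap.id ℝ V) {x : X}
    (hκ : k x x ≤ κ ^ 2) (h : H) : ‖h x‖ ≤ |κ| * ‖h‖ := by
  refine (RKHS.norm_apply_le h x).trans ?_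
  rw [← RKHS.norm_kerFun_eq_sqrt_norm_kernel, mul_comm]
  gcongr
  exact norm_kerFun_le hk hκ

theorem abs_kernel_le [Nontrivial V]
    (hk : ∀ x z, RKHS.kernel H x z = k x z • ContinuousLinearMap.id ℝ V)
    (hκ : ∀ x, k x x ≤ κ ^ 2) (x z : X) : |k x z| ≤ κ ^ 2 := by
  have hnorm : |k x z| = ‖RKHS.kernel H x z‖ := by
    rw [hk, norm_smul, ContinuousLinearMap.norm_id, mul_one, Real.norm_eq_abs]
  calc |k x z| ≤ ‖RKHS.kerFun H x‖ * ‖RKHS.kerFun H z‖ := by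
        simpa only [hnorm, RKHS.norm_kerFun_eq_sqrt_norm_kernel] using RKHS.norm_kernel_le H x z
    _ ≤ |κ| * |κ| := by
        gcongr
        · exact norm_kerFun_le hk (hκ x)
        · exact norm_kerFun_le hk (hκ z)
    _ = κ ^ 2 := by rw [abs_mul_abs_self, sq]

theorem norm_apply_sub_apply_le
    (hk : ∀ x z, RKHS.kernel H x z = k x z • ContinuousLinearMap.id ℝ V) {s t : X} {d : ℝ}
    (hd : 0 ≤ d) (hst : k s s + k t t - 2 * k s t ≤ d ^ 2) (h : H) :
    ‖h s - h t‖ ≤ d * ‖h‖ := by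
  have hdiff : ‖RKHS.kerFun H s - RKHS.kerFun H t‖ ≤ d := by
    refine ContinuousLinearMap.opNorm_le_bound _ hd fun v => le_of_sq_le_sq ?_ (by positivity)
    rw [sub_apply, norm_sub_sq_real, ← real_inner_self_eq_norm_sq,
      ← real_inner_self_eq_norm_sq, inner_kerFun_kerFun hk, inner_kerFun_kerFun hk,
      inner_kerFun_kerFun hk, mul_pow]
    calc _ = (k s s + k t t - 2 * k s t) * ‖v‖ ^ 2 := by ring
      _ ≤ d ^ 2 * ‖v‖ ^ 2 := by gcongr
  calc ‖h s - h t‖ = ‖(RKHS.kerFun H s - RKHS.kerFun H t).adjoint h‖ := by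
        rw [map_sub, sub_apply, RKHS.adjoint_kerFun, RKHS.adjoint_kerFun]
    _ ≤ ‖(RKHS.kerFun H s - RKHS.kerFun H t).adjoint‖ * ‖h‖ :=
        ContinuousLinearMap.le_opNorm _ _
    _ ≤ d * ‖h‖ := by
        rw [LinearIsometryEquiv.norm_map]
        gcongr

end Kernel

section SupDominated

variable {T HΘ : Type*} [NormedAddCommGroup HΘ] [InnerProductSpace ℝ HΘ] [RKHS ℝ HΘ T ℝ]

/-- The functional `⟪f, ·⟫` on the RKHS is bounded by `A` times the supremum norm. Tested on
differences of kernel functions, this makes `f` as smooth as the kernel, whatever its norm. -/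
def IsSupDominated (A : ℝ) (f : HΘ) : Prop :=
  ∀ (w : HΘ) (W : ℝ), (∀ θ : T, |w θ| ≤ W) → |inner ℝ f w| ≤ A * W

variable {A : ℝ} {f : HΘ} [CompleteSpace HΘ]

theorem inner_kerFun_one (f : HΘ) (θ : T) : inner ℝ f (RKHS.kerFun HΘ θ (1 : ℝ)) = f θ := by
  simp

theorem IsSupDominated.chordSlopesNear (hf : IsSupDominated A f) {Q : ℝ → T} {g : HΘ} {ε : ℝ}
    {s : Set ℝ}
    (hg : ∀ θ, ChordSlopesNear (fun u => RKHS.kerFun HΘ (Q u) (1 : ℝ) θ) (g θ) ε s) :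
    ChordSlopesNear (fun u => f (Q u)) (inner ℝ f g) (A * ε) s := fun x hx y hy => by
  have h := hf (RKHS.kerFun HΘ (Q x) (1 : ℝ) - RKHS.kerFun HΘ (Q y) (1 : ℝ) - (x - y) • g)
    (ε * |x - y|) fun θ => by
      simp only [RKHS.coe_sub, RKHS.coe_smul, Pi.sub_apply, Pi.smul_apply, smul_eq_mul]
      simpa only [mul_comm] using hg θ x hx y hy
  rw [inner_sub_right, inner_sub_right, real_inner_smul_right, inner_kerFun_one,
    inner_kerFun_one] at h
  rwa [mul_comm (inner ℝ f g), mul_assoc]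

theorem IsSupDominated.chordSlopesNear_slope (hf : IsSupDominated A f) {Q : ℝ → T} {ε a b : ℝ}
    {s : Set ℝ} (hQ : ∀ θ, ChordSlopesNear (fun u => RKHS.kerFun HΘ (Q u) (1 : ℝ) θ)
      (slope (fun u => RKHS.kerFun HΘ (Q u) (1 : ℝ) θ) a b) ε s) :
    ChordSlopesNear (fun u => f (Q u)) (slope (fun u => f (Q u)) a b) (A * ε) s := by
  have h := hf.chordSlopesNear (g := slope (fun u => RKHS.kerFun HΘ (Q u) (1 : ℝ)) a b)
    fun θ => by
      simpa only [slope_def_module, RKHS.coe_smul, RKHS.coe_sub, Pi.smul_apply, Pi.sub_apply]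
        using hQ θ
  simpa only [slope_def_module, real_inner_smul_right, inner_sub_right, inner_kerFun_one,
    smul_eq_mul] using h

end SupDominated

section UniformSmoothness

variable {τ : Task} {HΘ : Type*} [NormedAddCommGroup HΘ] [InnerProductSpace ℝ HΘ]
  [RKHS ℝ HΘ τ.Hyper ℝ] [CompleteSpace HΘ] {kΘ : ℝ → ℝ → ℝ} {A : ℝ}

theorem kerFun_one_apply
    (hΘ : ∀ s t : τ.Hyper, RKHS.kernel HΘ s t = kΘ s t • ContinuousLinearMap.id ℝ ℝ)
    (s t : τ.Hyper) : RKHS.kerFun HΘ t (1 : ℝ) s = kΘ s t := by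
  rw [kerFun_eq_smul hΘ, smul_eq_mul, mul_one]

theorem exists_abs_apply_sub_apply_le_of_isSupDominated
    (hΘ : ∀ s t : τ.Hyper, RKHS.kernel HΘ s t = kΘ s t • ContinuousLinearMap.id ℝ ℝ)
    (hk : ContDiffOn ℝ 1 (Function.uncurry kΘ) (Set.Icc τ.lo τ.hi ×ˢ Set.Icc τ.lo τ.hi))
    (hA : 0 ≤ A) :
    ∃ K, 0 ≤ K ∧ ∀ f : HΘ, IsSupDominated A f →
      ∀ s t : τ.Hyper, |f s - f t| ≤ K * |(s : ℝ) - t| := by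
  have hunique := uniqueDiffOn_Icc τ.lo_lt_hi
  have hswap : ContDiffOn ℝ 1 (Function.uncurry fun s θ => kΘ θ s)
      (Set.Icc τ.lo τ.hi ×ˢ Set.Icc τ.lo τ.hi) :=
    hk.comp (contDiff_snd.prodMk contDiff_fst).contDiffOn fun _ hp => Set.mk_mem_prod hp.2 hp.1
  obtain ⟨K, hK, hlip⟩ := exists_lipschitz_fst hunique hunique isCompact_Icc isCompact_Icc
    (convex_Icc _ _) hswap
  refine ⟨A * K, mul_nonneg hA hK, fun f hf s t => ?_⟩
  have hproj (u : τ.Hyper) : Set.projIcc τ.lo τ.hi τ.lo_le_hi u = u := Set.projIcc_val _ u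
  have h := hf.chordSlopesNear (Q := Set.projIcc τ.lo τ.hi τ.lo_le_hi) (g := 0) (ε := K)
    (s := Set.Icc τ.lo τ.hi) fun θ x hx y hy => by
      simpa only [RKHS.coe_zero, Pi.zero_apply, kerFun_one_apply hΘ,
        Set.projIcc_of_mem τ.lo_le_hi hx, Set.projIcc_of_mem τ.lo_le_hi hy]
        using hlip θ θ.2 x hx y hy
  simpa only [hproj, inner_zero_right, zero_mul, sub_zero] using h s s.2 t t.2

theorem contDiffOn_kernel_comp_affine
    (hk : ContDiffOn ℝ 1 (Function.uncurry kΘ) (Set.Icc τ.lo τ.hi ×ˢ Set.Icc τ.lo τ.hi)) :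
    ContDiffOn ℝ 1 (Function.uncurry fun u θ => kΘ θ (τ.lo + (τ.hi - τ.lo) * u))
      (Set.Icc 0 1 ×ˢ Set.Icc τ.lo τ.hi) := by
  have haffine : ContDiff ℝ 1 fun p : ℝ × ℝ => (p.2, τ.lo + (τ.hi - τ.lo) * p.1) := by fun_prop
  refine hk.comp haffine.contDiffOn fun p ⟨hu, hθ⟩ => ⟨hθ, ?_⟩
  beta_reduce
  rw [← coe_quantile_uniform τ hu]
  exact Subtype.coe_prop _

theorem eventually_chordSlopesNear_comp_quantile_uniform
    (hΘ : ∀ s t : τ.Hyper, RKHS.kernel HΘ s t = kΘ s t • ContinuousLinearMap.id ℝ ℝ)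
    (hk : ContDiffOn ℝ 1 (Function.uncurry kΘ) (Set.Icc τ.lo τ.hi ×ˢ Set.Icc τ.lo τ.hi))
    (hA : 0 ≤ A) {ε : ℝ} (hε : 0 < ε) :
    ∀ᶠ k : ℕ in Filter.atTop, ∀ f : HΘ, IsSupDominated A f → ∀ i : ℕ, i < 2 ^ k →
      ChordSlopesNear (fun u => f (quantile τ τ.uniform u))
        (slope (fun u => f (quantile τ τ.uniform u)) (i / 2 ^ k) ((i + 1) / 2 ^ k)) ε
        (dyadicCell k i) := by
  filter_upwards [eventually_chordSlopesNear_dyadicCell (uniqueDiffOn_Icc τ.lo_lt_hi)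
    isCompact_Icc (contDiffOn_kernel_comp_affine hk) (div_pos hε (by positivity : 0 < A + 1))]
    with k hcell f hf i hi
  have hkernel (θ : τ.Hyper) : Set.EqOn
      (fun u => RKHS.kerFun HΘ (quantile τ τ.uniform u) (1 : ℝ) θ)
      (fun u => kΘ θ (τ.lo + (τ.hi - τ.lo) * u)) (dyadicCell k i) := fun u hu => by
    simp only [kerFun_one_apply hΘ, coe_quantile_uniform τ (dyadicCell_subset_Icc hi hu)]
  have hslope (θ : τ.Hyper) := hcell i hi θ θ.2
  refine (hf.chordSlopesNear_slope (ε := ε / (A + 1)) fun θ x hx y hy => ?_).mono_right ?_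
  · simpa only [slope_def_field, hkernel θ (left_mem_dyadicCell k i),
      hkernel θ (right_mem_dyadicCell k i), hkernel θ hx, hkernel θ hy] using hslope θ x hx y hy
  · rw [mul_div_assoc', div_le_iff₀ (by positivity)]
    linarith

end UniformSmoothness

section NearlyAffineLoss

theorem IsBoundedBiaffine.exists_chordSlopesNear_dyadicCell {b F ℓ L : ℝ} {g : ℝ → ℝ → ℝ}
    {Q v : ℝ → ℝ} {k : ℕ} (hg : IsBoundedBiaffine b g) (hℓ : |ℓ| ≤ 2)
    (hQ1 : ∀ u ∈ Set.Icc 0 1, |Q u| ≤ 1) (hQ : ChordSlopesNear Q ℓ 0 (Set.Icc 0 1))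
    (hvF : ∀ u, |v u| ≤ F) (hvL : ChordSlopesNear v 0 L (Set.Icc 0 1))
    (hk : (2 * L + 1 / 48) * (1 / 2) ^ k ≤ 1 / 48) {i : ℕ} (hi : i < 2 ^ k)
    (hv : ChordSlopesNear v (slope v (i / 2 ^ k) ((i + 1) / 2 ^ k)) (1 / 48) (dyadicCell k i)) :
    ∃ p, |p| ≤ 2 * (L + b + F) ∧
      ChordSlopesNear (fun u => g (Q u) (v u)) p (1 / 12) (dyadicCell k i) := by
  have hsub := dyadicCell_subset_Icc hi
  have hleft := left_mem_dyadicCell k i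
  have hne : (i / 2 ^ k : ℝ) ≠ (i + 1) / 2 ^ k := by
    rw [Ne, div_left_inj' (by positivity)]
    simp
  have hslope : |slope v (i / 2 ^ k) ((i + 1) / 2 ^ k)| ≤ L := by
    simpa only [sub_zero] using
      hvL.abs_slope_sub_le (hsub hleft) (hsub (right_mem_dyadicCell k i)) hne
  obtain ⟨p, hp, hgp⟩ := hg.exists_chordSlopesNear hℓ (fun u hu => hQ1 u (hsub hu)) (hQ.mono hsub)
    (by norm_num) hleft (fun u hu => abs_sub_left_le_of_mem_dyadicCell hu) (hvF _) hslope hv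
  exact ⟨p, hp, hgp.mono_right (by linarith)⟩

variable {τ : Task} {y B F L : ℝ} {k : ℕ} {f : τ.Hyper → ℝ}

theorem abs_gridSum_loss_uniform_sub_le_of_nearly_affine (hy : y ∈ τ.outputs B)
    (hF : ∀ θ, |f θ| ≤ F)
    (hL : ChordSlopesNear (fun u => f (quantile τ τ.uniform u)) 0 L (Set.Icc 0 1))
    (hcell : ∀ i : ℕ, i < 2 ^ k → ChordSlopesNear (fun u => f (quantile τ τ.uniform u))
      (slope (fun u => f (quantile τ τ.uniform u)) (i / 2 ^ k) ((i + 1) / 2 ^ k)) (1 / 48)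
      (dyadicCell k i))
    (hk : (2 * L + 1 / 48) * (1 / 2) ^ k ≤ 1 / 48) {r : ℕ}
    (hr : 2 * (2 * (L + (|B| + 1) + F)) / 2 ^ r ≤ 1 / 2) {x x' : ℝ} (hx : x ∈ Set.Icc 0 1)
    (hx' : x' ∈ Set.Icc 0 1) :
    |gridSum (k + r) (fun u => τ.loss (quantile τ τ.uniform u) y (f (quantile τ τ.uniform u))) x -
      gridSum (k + r) (fun u => τ.loss (quantile τ τ.uniform u) y (f (quantile τ τ.uniform u))) x'|
        ≤ |B| + 1 + F + 1 := by
  set Q := quantile τ τ.uniform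
  obtain ⟨g₁, g₂, hg₁, hg₂, hloss⟩ := exists_loss_eq_biaffine_add_posPart hy
  have hlength : |τ.hi - τ.lo| ≤ 2 := by
    rw [abs_of_pos (sub_pos.2 τ.lo_lt_hi)]
    exact τ.hi_sub_lo_le
  have hQ : ChordSlopesNear (fun u => (Q u : ℝ)) (τ.hi - τ.lo) 0 (Set.Icc 0 1) :=
    fun u hu u' hu' => by
      simp only [Q, coe_quantile_uniform τ hu, coe_quantile_uniform τ hu', zero_mul]
      rw [add_sub_add_left_eq_sub, mul_sub, sub_self, abs_zero]
  have hbiaffine {g : ℝ → ℝ → ℝ} (hg : IsBoundedBiaffine (|B| + 1) g) (i : ℕ) (hi : i < 2 ^ k) :=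
    hg.exists_chordSlopesNear_dyadicCell hlength
      (fun u _ => abs_le_one_of_mem_Icc_lo_hi (Q u).2) hQ (fun u => hF (Q u)) hL hk hi
      (hcell i hi)
  have hsplit (u : ℝ) :
      τ.loss (Q u) y (f (Q u)) = g₁ (Q u) (f (Q u)) + max (g₂ (Q u) (f (Q u))) 0 :=
    hloss _ (Q u).2 _
  have hgrid := abs_gridSum_sub_le_of_nearly_affine hx hx' (fun i hi => by
    obtain ⟨p, -, hp⟩ := hbiaffine hg₁ i hi
    obtain ⟨q, hqL, hq⟩ := hbiaffine hg₂ i hi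
    exact ⟨p, q, hqL, hp, hq⟩) r
  simp only [← hsplit] at hgrid
  have hends : |τ.loss (Q 1) y (f (Q 1)) - τ.loss (Q 0) y (f (Q 0))| ≤ |B| + 1 + F :=
    abs_sub_le_of_nonneg_of_le (loss_nonneg (Q 1).2 _ _)
      ((loss_le hy (Q 1).2).trans (by gcongr; exact hF _)) (loss_nonneg (Q 0).2 _ _)
      ((loss_le hy (Q 0).2).trans (by gcongr; exact hF _))
  linarith

end NearlyAffineLoss

section Quadrature

variable {τ : Task} {HΘ : Type*} [NormedAddCommGroup HΘ] [InnerProductSpace ℝ HΘ]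
  [RKHS ℝ HΘ τ.Hyper ℝ] {y B F L : ℝ} {m : ℕ} {f : HΘ}

theorem continuous_loss_comp (hy : y ∈ τ.outputs B) (hF : ∀ θ : τ.Hyper, |f θ| ≤ F)
    (hf : ∀ s t : τ.Hyper, |f s - f t| ≤ L * |(s : ℝ) - t|) :
    Continuous fun θ : τ.Hyper => τ.loss θ y (f θ) := by
  refine (LipschitzWith.of_dist_le_mul (K := (2 * (2 * L + (|B| + 1) + F)).toNNReal)
    fun s t => ?_).continuous
  rw [Real.dist_eq, Subtype.dist_eq, Real.dist_eq]
  refine (abs_loss_sub_loss_le hy s.2 t.2 (hF t) (hf s t)).trans ?_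
  gcongr
  exact Real.le_coe_toNNReal _

variable (μ : Measure τ.Hyper) [IsProbabilityMeasure μ]

theorem integratedLoss_le_of_gridSum_le (hm : m ≠ 0) {β : ℕ → ℝ}
    (hc : Continuous fun θ : τ.Hyper => τ.loss θ y (f θ))
    (hβ : ∀ k, ∀ x ∈ Set.Icc (0 : ℝ) 1, ∀ x' ∈ Set.Icc (0 : ℝ) 1,
      |gridSum k (fun u => τ.loss (quantile τ μ u) y (f (quantile τ μ u))) x -
        gridSum k (fun u => τ.loss (quantile τ μ u) y (f (quantile τ μ u))) x'| ≤ β k) :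
    integratedLoss τ μ y f ≤
      sampledLoss τ μ m y f + (∑ k ∈ Finset.range m.size, β k) / m := by
  have hm0 : (0 : ℝ) < m := by positivity
  have herror := norm_sum_sobol_sub_integral_le m (intervalIntegrable_comp_quantile μ hc) hβ
  rw [Real.norm_eq_abs, integral_comp_quantile μ hc, smul_eq_mul] at herror
  unfold integratedLoss sampledLoss node
  rw [one_div, inv_mul_eq_div, ← add_div, le_div_iff₀ hm0]
  linarith [neg_le_of_abs_le herror]

theorem abs_gridSum_loss_sub_le (hy : y ∈ τ.outputs B) (hL : 0 ≤ L)
    (hF : ∀ θ : τ.Hyper, |f θ| ≤ F) (hf : ∀ s t : τ.Hyper, |f s - f t| ≤ L * |(s : ℝ) - t|) (k : ℕ)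
    {x x' : ℝ} (hx : x ∈ Set.Icc 0 1) (hx' : x' ∈ Set.Icc 0 1) :
    |gridSum k (fun u => τ.loss (quantile τ μ u) y (f (quantile τ μ u))) x -
      gridSum k (fun u => τ.loss (quantile τ μ u) y (f (quantile τ μ u))) x'| ≤
        4 * (2 * L + (|B| + 1) + F) := by
  have hF0 : 0 ≤ F := (abs_nonneg _).trans (hF (quantile τ μ 0))
  have hmono : MonotoneOn (fun u => (quantile τ μ u : ℝ)) (Set.Icc 0 1) :=
    fun u hu u' hu' h => monotoneOn_quantile μ hu.2 hu'.2 h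
  have hlength : (quantile τ μ 1 : ℝ) - quantile τ μ 0 ≤ 2 := by
    linarith [(quantile τ μ 1).2.2, (quantile τ μ 0).2.1, τ.hi_sub_lo_le]
  rw [← Real.norm_eq_abs]
  calc _ ≤ 2 * (2 * L + (|B| + 1) + F) * (quantile τ μ 1 - quantile τ μ 0) :=
        norm_gridSum_sub_le_of_monotoneOn (by positivity) hmono (fun u _ u' _ =>
          abs_loss_sub_loss_le hy (quantile τ μ u).2 (quantile τ μ u').2 (hF _) (hf _ _)) k hx hx'
    _ ≤ 2 * (2 * L + (|B| + 1) + F) * 2 := by gcongr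
    _ = 4 * (2 * L + (|B| + 1) + F) := by ring

theorem integratedLoss_le_of_lipschitz (hm : 2 ≤ m) (hy : y ∈ τ.outputs B) (hL : 0 ≤ L)
    (hF : ∀ θ : τ.Hyper, |f θ| ≤ F) (hf : ∀ s t : τ.Hyper, |f s - f t| ≤ L * |(s : ℝ) - t|) :
    integratedLoss τ μ y f ≤ sampledLoss τ μ m y f +
      12 * (2 * L + (|B| + 1) + F) * (Real.log m / m) := by
  have hF0 : 0 ≤ F := (abs_nonneg _).trans (hF (quantile τ μ 0))
  refine (integratedLoss_le_of_gridSum_le μ (show m ≠ 0 by omega) (continuous_loss_comp hy hF hf)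
    fun k x hx x' hx' => abs_gridSum_loss_sub_le μ hy hL hF hf k hx hx').trans ?_
  rw [Finset.sum_const, Finset.card_range, nsmul_eq_mul, mul_div_assoc', add_le_add_iff_left]
  refine div_le_div_of_nonneg_right ?_ (Nat.cast_nonneg m)
  calc (m.size : ℝ) * (4 * (2 * L + (|B| + 1) + F))
      ≤ 3 * Real.log m * (4 * (2 * L + (|B| + 1) + F)) := by
        gcongr
        exact natSize_le_three_mul_log hm
    _ = 12 * (2 * L + (|B| + 1) + F) * Real.log m := by ring

theorem sum_range_ite_lt_le (N k : ℕ) {c : ℝ} (hc : 0 ≤ c) :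
    ∑ i ∈ Finset.range N, (if i < k then c else 0) ≤ k * c := by
  rw [← Finset.sum_filter, Finset.sum_const, nsmul_eq_mul]
  gcongr
  have hsubset : (Finset.range N).filter (· < k) ⊆ Finset.range k := fun i hi =>
    Finset.mem_range.2 (Finset.mem_filter.1 hi).2
  simpa only [Finset.card_range] using Finset.card_le_card hsubset

end Quadrature

section UniformQuadrature

variable {τ : Task} {HΘ : Type*} [NormedAddCommGroup HΘ] [InnerProductSpace ℝ HΘ]
  [RKHS ℝ HΘ τ.Hyper ℝ] [CompleteSpace HΘ] {kΘ : ℝ → ℝ → ℝ} {A F : ℝ}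

theorem eventually_abs_gridSum_loss_uniform_sub_le
    (hΘ : ∀ s t : τ.Hyper, RKHS.kernel HΘ s t = kΘ s t • ContinuousLinearMap.id ℝ ℝ)
    (hk : ContDiffOn ℝ 1 (Function.uncurry kΘ) (Set.Icc τ.lo τ.hi ×ˢ Set.Icc τ.lo τ.hi))
    (B F : ℝ) (hA : 0 ≤ A) :
    ∀ᶠ k : ℕ in Filter.atTop, ∀ f : HΘ, (∀ θ : τ.Hyper, |f θ| ≤ F) → IsSupDominated A f →
      ∀ y ∈ τ.outputs B, ∀ x ∈ Set.Icc (0 : ℝ) 1, ∀ x' ∈ Set.Icc (0 : ℝ) 1,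
        |gridSum k (fun u => τ.loss (quantile τ τ.uniform u) y (f (quantile τ τ.uniform u))) x -
          gridSum k (fun u => τ.loss (quantile τ τ.uniform u) y (f (quantile τ τ.uniform u))) x'| ≤
            |B| + 1 + F + 1 := by
  obtain ⟨K, hK, hlip⟩ := exists_abs_apply_sub_apply_le_of_isSupDominated hΘ hk hA
  have hmesh : ∀ᶠ k : ℕ in Filter.atTop, (2 * (K * 2) + 1 / 48) * (1 / 2 : ℝ) ^ k ≤ 1 / 48 := by
    have hlim := (tendsto_pow_atTop_nhds_zero_of_lt_one (r := (1 / 2 : ℝ)) (by norm_num)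
      (by norm_num)).const_mul (2 * (K * 2) + 1 / 48)
    rw [mul_zero] at hlim
    exact hlim.eventually_le_const (by norm_num)
  have hramp : ∀ᶠ r : ℕ in Filter.atTop, 2 * (2 * (K * 2 + (|B| + 1) + F)) / 2 ^ r ≤ 1 / 2 :=
    (tendsto_const_nhds.div_atTop
      (tendsto_pow_atTop_atTop_of_one_lt one_lt_two)).eventually_le_const (by norm_num)
  obtain ⟨k, hcell, hk⟩ := ((eventually_chordSlopesNear_comp_quantile_uniform hΘ hk hA
    (by norm_num : (0 : ℝ) < 1 / 48)).and hmesh).exists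
  rw [← Filter.map_add_atTop_eq_nat k, Filter.eventually_map]
  filter_upwards [hramp] with r hr f hF hf y hy x hx x' hx'
  rw [add_comm r k]
  refine abs_gridSum_loss_uniform_sub_le_of_nearly_affine hy hF (fun u hu u' hu' => ?_)
    (hcell f hf) hk hr hx hx'
  rw [zero_mul, sub_zero]
  calc _ ≤ K * |(quantile τ τ.uniform u : ℝ) - quantile τ τ.uniform u'| := hlip f hf _ _
    _ = K * ((τ.hi - τ.lo) * |u - u'|) := by
        rw [coe_quantile_uniform τ hu, coe_quantile_uniform τ hu', add_sub_add_left_eq_sub,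
          ← mul_sub, abs_mul, abs_of_pos (sub_pos.2 τ.lo_lt_hi)]
    _ ≤ K * (2 * |u - u'|) := by
        gcongr
        exact τ.hi_sub_lo_le
    _ = K * 2 * |u - u'| := by ring

/- Only the finitely many coarse scales see the derivatives of the kernel, and `log m` outgrows
their contribution. -/
theorem eventually_integratedLoss_uniform_le
    (hΘ : ∀ s t : τ.Hyper, RKHS.kernel HΘ s t = kΘ s t • ContinuousLinearMap.id ℝ ℝ)
    (hk : ContDiffOn ℝ 1 (Function.uncurry kΘ) (Set.Icc τ.lo τ.hi ×ˢ Set.Icc τ.lo τ.hi))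
    (B : ℝ) (hA : 0 ≤ A) (hF0 : 0 ≤ F) :
    ∀ᶠ m : ℕ in Filter.atTop, ∀ f : HΘ, (∀ θ : τ.Hyper, |f θ| ≤ F) → IsSupDominated A f →
      ∀ y ∈ τ.outputs B, integratedLoss τ τ.uniform y f ≤ sampledLoss τ τ.uniform m y f +
        (3 * (|B| + 1 + F) + 4) * (Real.log m / m) := by
  have := isProbabilityMeasure_uniform τ
  obtain ⟨K, hK, hlip⟩ := exists_abs_apply_sub_apply_le_of_isSupDominated hΘ hk hA
  obtain ⟨k₁, hfine⟩ := Filter.eventually_atTop.1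
    (eventually_abs_gridSum_loss_uniform_sub_le hΘ hk B F hA)
  set c := 4 * (2 * K + (|B| + 1) + F)
  have hc : 0 ≤ c := by positivity
  have hlog : ∀ᶠ m : ℕ in Filter.atTop, k₁ * c ≤ Real.log m :=
    (Real.tendsto_log_atTop.comp tendsto_natCast_atTop_atTop).eventually_ge_atTop _
  filter_upwards [hlog, Filter.eventually_ge_atTop 2] with m hlogm hm f hF hf y hy
  refine (integratedLoss_le_of_gridSum_le τ.uniform (show m ≠ 0 by omega)
    (β := fun k => (if k < k₁ then c else 0) + (|B| + 1 + F + 1))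
    (continuous_loss_comp hy hF (hlip f hf)) fun k x hx x' hx' => ?_).trans ?_
  · split_ifs with hkk
    · have hcoarse := abs_gridSum_loss_sub_le τ.uniform hy hK hF (hlip f hf) k hx hx'
      exact hcoarse.trans (le_add_of_nonneg_right (by positivity))
    · rw [zero_add]
      exact hfine k (not_lt.1 hkk) f hF hf y hy x hx x' hx'
  · rw [mul_div_assoc', add_le_add_iff_left]
    gcongr
    calc ∑ k ∈ Finset.range m.size, ((if k < k₁ then c else 0) + (|B| + 1 + F + 1))
        ≤ k₁ * c + m.size * (|B| + 1 + F + 1) := by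
          rw [Finset.sum_add_distrib, Finset.sum_const, Finset.card_range, nsmul_eq_mul]
          gcongr
          exact sum_range_ite_lt_le _ _ hc
      _ ≤ Real.log m + 3 * Real.log m * (|B| + 1 + F + 1) := by
          gcongr
          exact natSize_le_three_mul_log hm
      _ = (3 * (|B| + 1 + F) + 4) * Real.log m := by ring

end UniformQuadrature

section Solution

theorem one_div_mul_sum_one_div_mul_sum_le {n : ℕ} (m : ℕ) {a : Fin n → ℕ → ℝ} {C : ℝ}
    (hC : 0 ≤ C) (ha : ∀ i j, a i j ≤ C) :
    (1 / n : ℝ) * ∑ i, (1 / m : ℝ) * ∑ j ∈ Finset.range m, a i j ≤ C := by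
  have haverage {ι : Type} (s : Finset ι) {b : ι → ℝ} (hb : ∀ i, b i ≤ C) :
      (1 / s.card : ℝ) * ∑ i ∈ s, b i ≤ C := by
    rw [one_div, inv_mul_eq_div]
    refine div_le_of_le_mul₀ (Nat.cast_nonneg _) hC ?_
    simpa only [nsmul_eq_mul, mul_comm] using Finset.sum_le_card_nsmul s b C fun i _ => hb i
  have hinner (i : Fin n) := haverage (Finset.range m) (ha i)
  simp only [Finset.card_range] at hinner
  simpa only [Finset.card_univ, Fintype.card_fin] using haverage Finset.univ hinner

variable {𝒳 HΘ H : Type*} {τ : Task}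
  [NormedAddCommGroup HΘ] [InnerProductSpace ℝ HΘ] [RKHS ℝ HΘ τ.Hyper ℝ]
  [NormedAddCommGroup H] [InnerProductSpace ℝ H] [RKHS ℝ H 𝒳 HΘ]

theorem integratedLoss_nonneg (μ : Measure τ.Hyper) (y : ℝ) (f : HΘ) :
    0 ≤ integratedLoss τ μ y f :=
  integral_nonneg fun θ => loss_nonneg θ.2 _ _

variable (μ : Measure τ.Hyper) (m : ℕ) {n : ℕ} (S : Fin n → 𝒳 × ℝ)

theorem sampledEmpiricalRisk_nonneg (h : H) : 0 ≤ sampledEmpiricalRisk τ μ m S h :=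
  mul_nonneg (by positivity) (Finset.sum_nonneg fun _ _ =>
    mul_nonneg (by positivity) (Finset.sum_nonneg fun j _ => loss_nonneg (node τ μ j).2 _ _))

theorem sampledEmpiricalRisk_midpoint_le (g h : H) :
    sampledEmpiricalRisk τ μ m S ((1 / 2 : ℝ) • (g + h)) ≤
      (sampledEmpiricalRisk τ μ m S g + sampledEmpiricalRisk τ μ m S h) / 2 := by
  have hloss (x : 𝒳) (y : ℝ) (θ : τ.Hyper) : τ.loss θ y (((1 / 2 : ℝ) • (g + h)) x θ) ≤
      (τ.loss θ y (g x θ) + τ.loss θ y (h x θ)) / 2 := by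
    convert loss_midpoint_le (τ := τ) θ y (g x θ) (h x θ) using 2
    simp only [RKHS.coe_smul, RKHS.coe_add, Pi.smul_apply, Pi.add_apply, smul_eq_mul]
    ring
  unfold sampledEmpiricalRisk sampledLoss
  rw [← mul_add, mul_div_assoc, ← Finset.sum_add_distrib, Finset.sum_div]
  gcongr
  rw [← mul_add, mul_div_assoc, ← Finset.sum_add_distrib, Finset.sum_div]
  gcongr
  exact hloss _ _ _

theorem continuous_sampledEmpiricalRisk :
    Continuous fun h : H => sampledEmpiricalRisk τ μ m S h :=
  continuous_const.mul <| continuous_finsetSum _ fun i _ =>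
    continuous_const.mul <| continuous_finsetSum _ fun j _ => (continuous_loss _ _).comp <|
      (RKHS.continuous_eval (H := HΘ) (node τ μ j)).comp (RKHS.continuous_eval (H := H) (S i).1)

theorem existsUnique_isSolution [CompleteSpace H] {lam : ℝ} (hlam : 0 < lam) :
    ∃! h : H, IsSolution τ μ lam m S h :=
  existsUnique_ridge_minimizer hlam (continuous_sampledEmpiricalRisk μ m S)
    (sampledEmpiricalRisk_nonneg μ m S) (sampledEmpiricalRisk_midpoint_le μ m S)

variable {B : ℝ} {lam : ℝ} {h : H} {μ m S}

theorem IsSolution.norm_le (hlam : 0 < lam) (hS : ∀ i, (S i).2 ∈ τ.outputs B)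
    (hh : IsSolution τ μ lam m S h) : ‖h‖ ≤ √(2 * (|B| + 1)) / √lam := by
  refine norm_le_of_ridge_minimizer hlam (sampledEmpiricalRisk_nonneg μ m S) ?_ hh
  refine one_div_mul_sum_one_div_mul_sum_le m (by positivity) fun i j => ?_
  simpa only [RKHS.coe_zero, Pi.zero_apply] using loss_zero_le (hS i) (node τ μ j).2

theorem IsSolution.isSupDominated [CompleteSpace HΘ] [CompleteSpace H] {kX : 𝒳 → 𝒳 → ℝ} {κX : ℝ}
    (hX : ∀ x z : 𝒳, RKHS.kernel H x z = kX x z • ContinuousLinearMap.id ℝ HΘ)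
    (hκ : ∀ x, kX x x ≤ κX ^ 2) (hlam : 0 < lam) (hS : ∀ i, (S i).2 ∈ τ.outputs B)
    (hh : IsSolution τ μ lam m S h) (x : 𝒳) : IsSupDominated (κX ^ 2 / lam) (h x) := by
  intro w W hw
  have hW : 0 ≤ W := (abs_nonneg _).trans (hw ⟨τ.lo, le_rfl, τ.lo_le_hi⟩)
  rcases subsingleton_or_nontrivial HΘ with _ | _
  · rw [Subsingleton.elim w 0, inner_zero_right, abs_zero]
    positivity
  rw [← RKHS.inner_kerFun, div_mul_eq_mul_div]
  refine abs_inner_le_of_ridge_minimizer hlam hh fun t => ?_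
  have hvalue (z : 𝒳) (θ : τ.Hyper) :
      (h + t • RKHS.kerFun H x w) z θ = h z θ + t * (kX z x * w θ) := by
    simp only [RKHS.coe_add, RKHS.coe_smul, Pi.add_apply, Pi.smul_apply, smul_eq_mul,
      kerFun_eq_smul hX]
  have hloss (i : Fin n) (θ : τ.Hyper) : τ.loss θ (S i).2 ((h + t • RKHS.kerFun H x w) (S i).1 θ) -
      τ.loss θ (S i).2 (h (S i).1 θ) ≤ |t| * (κX ^ 2 * W) := by
    refine (Real.sub_le_dist _ _).trans (((lipschitzWith_loss (hS i) θ.2).dist_le_mul _ _).trans ?_)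
    rw [NNReal.coe_one, one_mul, hvalue, dist_self_add_left, Real.norm_eq_abs, abs_mul, abs_mul]
    gcongr
    · exact abs_kernel_le hX hκ _ _
    · exact hw θ
  unfold sampledEmpiricalRisk sampledLoss
  simp only [← mul_sub, ← Finset.sum_sub_distrib]
  exact one_div_mul_sum_one_div_mul_sum_le m (by positivity) fun i j => hloss i _

end Solution

section PointFeature

variable {𝒳 T HΘ H : Type*} [NormedAddCommGroup HΘ] [InnerProductSpace ℝ HΘ] [CompleteSpace HΘ]
  [RKHS ℝ HΘ T ℝ] [NormedAddCommGroup H] [InnerProductSpace ℝ H] [CompleteSpace H] [RKHS ℝ H 𝒳 HΘ]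

/-- The element of `H` that represents the functional `h ↦ h x θ`. -/
def pointFeature (H : Type*) [NormedAddCommGroup H] [InnerProductSpace ℝ H] [CompleteSpace H]
    [RKHS ℝ H 𝒳 HΘ] (x : 𝒳) (θ : T) : H :=
  RKHS.kerFun H x (RKHS.kerFun HΘ θ (1 : ℝ))

theorem inner_pointFeature (h : H) (x : 𝒳) (θ : T) : inner ℝ h (pointFeature H x θ) = h x θ := by
  rw [pointFeature, RKHS.inner_kerFun, inner_kerFun_one]

variable {kX : 𝒳 → 𝒳 → ℝ} {kΘ : T → T → ℝ} {κX κΘ : ℝ}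

theorem norm_pointFeature_le
    (hΘ : ∀ s t : T, RKHS.kernel HΘ s t = kΘ s t • ContinuousLinearMap.id ℝ ℝ)
    (hX : ∀ x z : 𝒳, RKHS.kernel H x z = kX x z • ContinuousLinearMap.id ℝ HΘ)
    (hκX : ∀ x, kX x x ≤ κX ^ 2) (hκΘ : ∀ θ, kΘ θ θ ≤ κΘ ^ 2) (x : 𝒳) (θ : T) :
    ‖pointFeature H x θ‖ ≤ |κX| * |κΘ| := by
  have hone : ‖RKHS.kerFun HΘ θ (1 : ℝ)‖ ≤ |κΘ| := by
    simpa only [norm_one, mul_one] using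
      (RKHS.kerFun HΘ θ).le_of_opNorm_le (norm_kerFun_le hΘ (hκΘ θ)) (1 : ℝ)
  exact ((RKHS.kerFun H x).le_of_opNorm_le (norm_kerFun_le hX (hκX x)) _).trans (by gcongr)

theorem measurable_inner_pointFeature [MeasurableSpace 𝒳]
    (hX : ∀ x z : 𝒳, RKHS.kernel H x z = kX x z • ContinuousLinearMap.id ℝ HΘ)
    (hXm : Measurable (Function.uncurry kX)) (θ : T) :
    Measurable fun p : 𝒳 × 𝒳 => inner ℝ (pointFeature H p.1 θ) (pointFeature H p.2 θ) := by
  simp only [pointFeature, inner_kerFun_kerFun hX]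
  exact hXm.mul_const _

end PointFeature

section AdmissibleLoss

variable {τ : Task} {B θ y : ℝ}

/-- The local loss, set to `0` for outputs that are not admissible: only thus is it Lipschitz in
the prediction, and bounded at `0`, for every output. -/
def admissibleLoss (τ : Task) (B θ y t : ℝ) : ℝ :=
  (τ.outputs B).indicator (fun y => τ.loss θ y t) y

theorem admissibleLoss_of_mem (hy : y ∈ τ.outputs B) (t : ℝ) :
    admissibleLoss τ B θ y t = τ.loss θ y t :=
  Set.indicator_of_mem hy _

theorem measurable_admissibleLoss :
    Measurable fun p : ℝ × ℝ => admissibleLoss τ B θ p.1 p.2 :=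
  (measurable_loss θ).indicator (measurable_fst (measurableSet_outputs τ B))

variable (hθ : θ ∈ Set.Icc τ.lo τ.hi)
include hθ

theorem lipschitzWith_admissibleLoss (y : ℝ) : LipschitzWith 1 (admissibleLoss τ B θ y) := by
  by_cases hy : y ∈ τ.outputs B
  · simpa only [funext (admissibleLoss_of_mem (θ := θ) hy)] using lipschitzWith_loss hy hθ
  · have hzero : admissibleLoss τ B θ y = fun _ => 0 :=
      funext fun t => Set.indicator_of_notMem hy _
    rw [hzero]
    exact LipschitzWith.const' 0

theorem abs_admissibleLoss_zero_le (y : ℝ) : |admissibleLoss τ B θ y 0| ≤ |B| + 1 := by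
  by_cases hy : y ∈ τ.outputs B
  · rw [admissibleLoss_of_mem hy, abs_of_nonneg (loss_nonneg hθ _ _)]
    exact loss_zero_le hy hθ
  · rw [admissibleLoss, Set.indicator_of_notMem hy, abs_zero]
    positivity

end AdmissibleLoss

section Generalization

variable {𝒳 HΘ H : Type*} {τ : Task} [MeasurableSpace 𝒳]
  [NormedAddCommGroup HΘ] [InnerProductSpace ℝ HΘ] [RKHS ℝ HΘ τ.Hyper ℝ]
  [NormedAddCommGroup H] [InnerProductSpace ℝ H] [RKHS ℝ H 𝒳 HΘ]

/-- The risk with the `μ`-integral replaced by the quasi-Monte Carlo mean: it lies between the true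
and the sampled empirical risk. -/
def sampledRisk (μ : Measure τ.Hyper) (m : ℕ) (P : Measure (𝒳 × ℝ)) (h : H) : ℝ :=
  ∫ z : 𝒳 × ℝ, sampledLoss τ μ m z.2 (h z.1) ∂P

variable [CompleteSpace HΘ] [CompleteSpace H] {P : Measure (𝒳 × ℝ)} [IsProbabilityMeasure P]
  {B κ ρ : ℝ}

theorem integrable_loss_apply {θ : τ.Hyper}
    (hm : Measurable fun p : 𝒳 × 𝒳 => inner ℝ (pointFeature H p.1 θ) (pointFeature H p.2 θ))
    (hκ : ∀ x, ‖pointFeature H x θ‖ ≤ κ) (hP : ∀ᵐ z ∂P, z.2 ∈ τ.outputs B) (h : H) :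
    Integrable (fun z : 𝒳 × ℝ => τ.loss θ z.2 (h z.1 θ)) P := by
  have happly : Measurable fun x : 𝒳 => h x θ := by
    simpa only [inner_pointFeature] using
      measurable_inner_of_measurable_kernel (ψ := fun x => pointFeature H x θ) hm h
  refine Integrable.of_bound ((measurable_loss θ).comp
    (measurable_snd.prodMk (happly.comp measurable_fst))).aestronglyMeasurable
    (|B| + 1 + ‖h‖ * κ) ?_
  filter_upwards [hP] with z hz
  rw [Real.norm_of_nonneg (loss_nonneg θ.2 _ _)]
  refine (loss_le hz θ.2).trans ?_
  rw [← inner_pointFeature]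
  gcongr
  exact (abs_real_inner_le_norm _ _).trans (by gcongr; exact hκ _)

theorem exists_uniform_deviation_loss {θ : τ.Hyper}
    (hm : Measurable fun p : 𝒳 × 𝒳 => inner ℝ (pointFeature H p.1 θ) (pointFeature H p.2 θ))
    (hκ0 : 0 ≤ κ) (hκ : ∀ x, ‖pointFeature H x θ‖ ≤ κ) (hP : ∀ᵐ z ∂P, z.2 ∈ τ.outputs B)
    (hρ : 0 < ρ) (n : ℕ) :
    ∃ Φ : (Fin n → 𝒳 × ℝ) → ENNReal, Measurable Φ ∧
      ∫⁻ S, Φ S ∂(Measure.pi fun _ => P) ≤ ENNReal.ofReal (2 * (√n * (ρ * κ + (|B| + 1)))) ∧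
      ∀ S : Fin n → 𝒳 × ℝ, (∀ i, (S i).2 ∈ τ.outputs B) → ∀ h : H, ‖h‖ ≤ ρ →
        ENNReal.ofReal (n * ∫ z, τ.loss θ z.2 (h z.1 θ) ∂P -
          ∑ i, τ.loss θ (S i).2 (h (S i).1 θ)) ≤ Φ S := by
  have hψm : Measurable fun p : (𝒳 × ℝ) × (𝒳 × ℝ) =>
      inner ℝ (pointFeature H p.1.1 θ) (pointFeature H p.2.1 θ) :=
    (hm.comp (measurable_fst.fst.prodMk measurable_snd.fst) :)
  have hφm : Measurable (Function.uncurry fun z : 𝒳 × ℝ => admissibleLoss τ B θ z.2) :=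
    measurable_admissibleLoss.comp (measurable_fst.snd.prodMk measurable_snd)
  have hdeviation := exists_uniform_deviation (P := P) (κ := κ) (ρ := ρ)
    (ψ := fun z => pointFeature H z.1 θ) (φ := fun z => admissibleLoss τ B θ z.2) (L := |B| + 1)
  obtain ⟨Φ, hΦm, hΦ, hdev⟩ := hdeviation hψm hφm hκ0 (fun z => hκ z.1) hρ
    (fun z => lipschitzWith_admissibleLoss θ.2 z.2) (by positivity)
    (fun z => abs_admissibleLoss_zero_le θ.2 z.2) n
  refine ⟨Φ, hΦm, hΦ, fun S hS h hh => ?_⟩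
  have hint : ∫ z, admissibleLoss τ B θ z.2 (h z.1 θ) ∂P = ∫ z, τ.loss θ z.2 (h z.1 θ) ∂P :=
    integral_congr_ae (by filter_upwards [hP] with z hz using admissibleLoss_of_mem hz _)
  simpa only [inner_pointFeature, hint, admissibleLoss_of_mem (hS _)] using hdev S h hh

variable (hm : ∀ θ : τ.Hyper, Measurable fun p : 𝒳 × 𝒳 =>
  inner ℝ (pointFeature H p.1 θ) (pointFeature H p.2 θ))
  (hκ : ∀ x (θ : τ.Hyper), ‖pointFeature H x θ‖ ≤ κ) (hP : ∀ᵐ z ∂P, z.2 ∈ τ.outputs B)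
include hm hκ hP

theorem sampledRisk_eq_one_div_mul_sum (μ : Measure τ.Hyper) (m : ℕ) (h : H) :
    sampledRisk μ m P h = (1 / m : ℝ) * ∑ j ∈ Finset.range m,
      ∫ z, τ.loss (node τ μ j) z.2 (h z.1 (node τ μ j)) ∂P := by
  unfold sampledRisk sampledLoss
  rw [integral_const_mul, integral_finsetSum _ fun j _ =>
    integrable_loss_apply (hm _) (fun x => hκ x _) hP h]

theorem risk_le_sampledRisk_add (μ : Measure τ.Hyper) (m : ℕ) {h : H} {q : ℝ}
    (hq : ∀ x, ∀ y ∈ τ.outputs B, integratedLoss τ μ y (h x) ≤ sampledLoss τ μ m y (h x) + q) :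
    risk τ μ P h ≤ sampledRisk μ m P h + q := by
  have hint : Integrable (fun z : 𝒳 × ℝ => sampledLoss τ μ m z.2 (h z.1)) P :=
    (integrable_finsetSum _ fun j _ =>
      integrable_loss_apply (hm _) (fun x => hκ x _) hP h).const_mul _
  calc risk τ μ P h ≤ ∫ z, (sampledLoss τ μ m z.2 (h z.1) + q) ∂P := by
        refine integral_mono_of_nonneg (ae_of_all _ fun z => integratedLoss_nonneg _ _ _)
          (hint.add (integrable_const q)) ?_
        filter_upwards [hP] with z hz using hq z.1 z.2 hz
    _ = sampledRisk μ m P h + q := by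
        rw [integral_add hint (integrable_const q), integral_const, probReal_univ, one_smul,
          sampledRisk]

theorem exists_uniform_deviation_sampledRisk (hκ0 : 0 ≤ κ) (μ : Measure τ.Hyper) (m : ℕ)
    (hρ : 0 < ρ) {n : ℕ} (hn : n ≠ 0) :
    ∃ Φ : (Fin n → 𝒳 × ℝ) → ENNReal, Measurable Φ ∧
      ∫⁻ S, Φ S ∂(Measure.pi fun _ => P) ≤ ENNReal.ofReal (2 * (√n * (ρ * κ + (|B| + 1)))) ∧
      ∀ S : Fin n → 𝒳 × ℝ, (∀ i, (S i).2 ∈ τ.outputs B) → ∀ h : H, ‖h‖ ≤ ρ →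
        ENNReal.ofReal (n * (sampledRisk μ m P h - sampledEmpiricalRisk τ μ m S h)) ≤ Φ S := by
  choose Φ hΦm hΦ hdev using fun j : ℕ => exists_uniform_deviation_loss (hm (node τ μ j)) hκ0
    (fun x => hκ x _) hP hρ n
  refine ⟨fun S => ENNReal.ofReal (1 / m) * ∑ j ∈ Finset.range m, Φ j S,
    (Finset.measurable_sum _ fun j _ => hΦm j).const_mul _, ?_, fun S hS h hh => ?_⟩
  · rw [lintegral_const_mul _ (Finset.measurable_sum _ fun j _ => hΦm j),
      lintegral_finsetSum _ fun j _ => hΦm j]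
    set V := 2 * (√n * (ρ * κ + (|B| + 1)))
    calc _ ≤ ENNReal.ofReal (1 / m) * ∑ _ ∈ Finset.range m, ENNReal.ofReal V := by
          gcongr
          exact hΦ _
      _ = ENNReal.ofReal (m / m * V) := by
          rw [Finset.sum_const, Finset.card_range, nsmul_eq_mul, ← ENNReal.ofReal_natCast,
            ← ENNReal.ofReal_mul (by positivity), ← ENNReal.ofReal_mul (by positivity)]
          ring_nf
      _ ≤ ENNReal.ofReal V :=
          ENNReal.ofReal_le_ofReal (mul_le_of_le_one_left (by positivity) (div_self_le_one _))
  · have hmean : n * (sampledRisk μ m P h - sampledEmpiricalRisk τ μ m S h) =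
        1 / m * ∑ j ∈ Finset.range m, (n * ∫ z, τ.loss (node τ μ j) z.2 (h z.1 (node τ μ j)) ∂P -
          ∑ i, τ.loss (node τ μ j) (S i).2 (h (S i).1 (node τ μ j))) := by
      unfold sampledEmpiricalRisk sampledLoss
      rw [sampledRisk_eq_one_div_mul_sum hm hκ hP, ← Finset.mul_sum, Finset.sum_comm,
        Finset.sum_sub_distrib, ← Finset.mul_sum]
      field_simp
    rw [hmean, ENNReal.ofReal_mul (by positivity)]
    refine mul_le_mul_right ((Finset.le_sum_of_subadditive ENNReal.ofReal ENNReal.ofReal_zero.le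
      (fun _ _ => ENNReal.ofReal_add_le) _ _).trans ?_) _
    exact Finset.sum_le_sum fun j _ => hdev j S hS h hh

theorem measure_lt_sampledRisk_le (hκ0 : 0 ≤ κ) (μ : Measure τ.Hyper) (m : ℕ) (hρ : 0 < ρ) {n : ℕ}
    (hn : n ≠ 0) {δ t : ℝ} (hδ : 0 < δ) (ht : 2 * (√n * (ρ * κ + (|B| + 1))) ≤ δ * (n * t)) :
    Measure.pi (fun _ : Fin n => P) {S | (∀ i, (S i).2 ∈ τ.outputs B) ∧
      ∃ h : H, ‖h‖ ≤ ρ ∧ sampledEmpiricalRisk τ μ m S h + t < sampledRisk μ m P h} ≤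
        ENNReal.ofReal δ := by
  obtain ⟨Φ, hΦm, hΦ, hdev⟩ := exists_uniform_deviation_sampledRisk hm hκ hP hκ0 μ m hρ hn
  have hnt : 0 < n * t := by
    have hpos : 0 < 2 * (√n * (ρ * κ + (|B| + 1))) := by positivity
    exact pos_of_mul_pos_right (hpos.trans_le ht) hδ.le
  calc _ ≤ Measure.pi (fun _ : Fin n => P) {S | ENNReal.ofReal (n * t) ≤ Φ S} := by
        refine measure_mono ?_
        rintro S ⟨hS, h, hh, hlt⟩
        refine le_trans (ENNReal.ofReal_le_ofReal ?_) (hdev S hS h hh)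
        gcongr
        linarith
    _ ≤ (∫⁻ S, Φ S ∂(Measure.pi fun _ => P)) / ENNReal.ofReal (n * t) :=
        meas_ge_le_lintegral_div hΦm.aemeasurable (ENNReal.ofReal_pos.2 hnt).ne'
          ENNReal.ofReal_ne_top
    _ ≤ ENNReal.ofReal δ := by
        refine ENNReal.div_le_of_le_mul (hΦ.trans ?_)
        rw [← ENNReal.ofReal_mul hδ.le]
        exact ENNReal.ofReal_le_ofReal ht

end Generalization

section Constants

variable {κX κΘ κ B D Λ lam δ : ℝ}

/-- The constant `C₁(δ)` of the generalization bound, for features of norm at most `κ`: the factor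
`1 / δ` is the price of Markov's inequality. -/
def deviationConst (κ B Λ δ : ℝ) : ℝ :=
  2 * (√(2 * (|B| + 1)) * κ + (|B| + 1) * √Λ) / δ

/-- The constant `C₂` of the generalization bound. -/
def quadratureConst (κX κΘ B D Λ : ℝ) : ℝ :=
  (12 * (|B| + 1) + 4) * √Λ + 12 * √(2 * (|B| + 1)) * |κX| * (2 * |D| + |κΘ|)

theorem deviation_le_deviationConst_div (hκ : 0 ≤ κ) (hlam : 0 < lam) (hΛ : lam ≤ Λ) (hδ : 0 < δ)
    {n : ℕ} (hn : n ≠ 0) :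
    2 * (√n * (√(2 * (|B| + 1)) / √lam * κ + (|B| + 1))) ≤
      δ * (n * (deviationConst κ B Λ δ / √(lam * n))) := by
  have : 0 < √lam := Real.sqrt_pos.2 hlam
  have : 0 < √(n : ℝ) := Real.sqrt_pos.2 (by positivity)
  calc 2 * (√n * (√(2 * (|B| + 1)) / √lam * κ + (|B| + 1)))
      = 2 * (√(2 * (|B| + 1)) * κ + (|B| + 1) * √lam) * √n / √lam := by field_simp
    _ ≤ 2 * (√(2 * (|B| + 1)) * κ + (|B| + 1) * √Λ) * √n / √lam := by gcongr
    _ = δ * (n * (deviationConst κ B Λ δ / √(lam * n))) := by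
        rw [deviationConst, Real.sqrt_mul hlam.le]
        field_simp
        rw [Real.sq_sqrt n.cast_nonneg]

theorem mul_log_div_le_of_le_quadratureConst (hlam : 0 < lam) {c : ℝ} {m : ℕ}
    (hc : c * √lam ≤ quadratureConst κX κΘ B D Λ) :
    c * (Real.log m / m) ≤ quadratureConst κX κΘ B D Λ * (Real.log m / (√lam * m)) := by
  have : 0 < √lam := Real.sqrt_pos.2 hlam
  calc c * (Real.log m / m) = c * √lam * (Real.log m / (√lam * m)) := by field_simp
    _ ≤ _ := mul_le_mul_of_nonneg_right hc
      (div_nonneg (Real.log_natCast_nonneg m) (by positivity))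

end Constants

section Solution

variable {𝒳 HΘ H : Type*} {τ : Task}
  [NormedAddCommGroup HΘ] [InnerProductSpace ℝ HΘ] [CompleteSpace HΘ] [RKHS ℝ HΘ τ.Hyper ℝ]
  [NormedAddCommGroup H] [InnerProductSpace ℝ H] [CompleteSpace H] [RKHS ℝ H 𝒳 HΘ]
  {B lam Λ : ℝ} {μ : Measure τ.Hyper} {m n : ℕ} {S : Fin n → 𝒳 × ℝ} {h : H}

theorem measure_isSolution_risk_gt_le [MeasurableSpace 𝒳] {P : Measure (𝒳 × ℝ)}
    [IsProbabilityMeasure P] {κ δ q : ℝ}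
    (hm : ∀ θ : τ.Hyper, Measurable fun p : 𝒳 × 𝒳 =>
      inner ℝ (pointFeature H p.1 θ) (pointFeature H p.2 θ))
    (hκ0 : 0 ≤ κ) (hκ : ∀ x (θ : τ.Hyper), ‖pointFeature H x θ‖ ≤ κ)
    (hP : ∀ᵐ z ∂P, z.2 ∈ τ.outputs B) (hlam : 0 < lam) (hΛ : lam ≤ Λ) (hδ : 0 < δ) (hn : n ≠ 0)
    (hq : ∀ S : Fin n → 𝒳 × ℝ, (∀ i, (S i).2 ∈ τ.outputs B) → ∀ h : H,
      IsSolution τ μ lam m S h → ∀ x, ∀ y ∈ τ.outputs B,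
        integratedLoss τ μ y (h x) ≤ sampledLoss τ μ m y (h x) + q) :
    Measure.pi (fun _ : Fin n => P) {S | ∃ h : H, IsSolution τ μ lam m S h ∧
      ¬ (risk τ μ P h ≤
        sampledEmpiricalRisk τ μ m S h + deviationConst κ B Λ δ / √(lam * n) + q)} ≤
      ENNReal.ofReal δ := by
  have hρ : 0 < √(2 * (|B| + 1)) / √lam := by positivity
  refine le_trans (measure_mono_ae ?_) (measure_lt_sampledRisk_le hm hκ hP hκ0 μ m hρ hn hδ
    (deviation_le_deviationConst_div hκ0 hlam hΛ hδ hn))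
  have hae : ∀ᵐ S ∂Measure.pi (fun _ : Fin n => P), ∀ i, (S i).2 ∈ τ.outputs B :=
    Filter.eventually_all.2 fun i =>
      (Measure.tendsto_eval_ae_ae (μ := fun _ : Fin n => P) (i := i)).eventually hP
  filter_upwards [hae] with S hS
  rintro ⟨h, hsol, hfail⟩
  have hrisk := risk_le_sampledRisk_add hm hκ hP μ m (hq S hS h hsol)
  exact ⟨hS, h, hsol.norm_le hlam hS, by linarith⟩

variable {kX : 𝒳 → 𝒳 → ℝ} {κX κΘ D : ℝ}
  (hX : ∀ x z : 𝒳, RKHS.kernel H x z = kX x z • ContinuousLinearMap.id ℝ HΘ)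
  (hκX : ∀ x, kX x x ≤ κX ^ 2)
include hX hκX

theorem IsSolution.norm_apply_le (hlam : 0 < lam) (hS : ∀ i, (S i).2 ∈ τ.outputs B)
    (hh : IsSolution τ μ lam m S h) (x : 𝒳) : ‖h x‖ ≤ |κX| * (√(2 * (|B| + 1)) / √lam) :=
  (norm_apply_le_mul_norm hX (hκX x) h).trans (by gcongr; exact hh.norm_le hlam hS)

variable {kΘ : ℝ → ℝ → ℝ}
  (hΘ : ∀ s t : τ.Hyper, RKHS.kernel HΘ s t = kΘ s t • ContinuousLinearMap.id ℝ ℝ)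
  (hκΘ : ∀ θ ∈ Set.Icc τ.lo τ.hi, kΘ θ θ ≤ κΘ ^ 2)
include hΘ hκΘ

theorem IsSolution.abs_apply_apply_le (hlam : 0 < lam) (hS : ∀ i, (S i).2 ∈ τ.outputs B)
    (hh : IsSolution τ μ lam m S h) (x : 𝒳) (θ : τ.Hyper) :
    |h x θ| ≤ |κΘ| * (|κX| * (√(2 * (|B| + 1)) / √lam)) :=
  (norm_apply_le_mul_norm (k := fun s t : τ.Hyper => kΘ s t) hΘ (hκΘ θ θ.2) (h x)).trans
    (by gcongr; exact hh.norm_apply_le hX hκX hlam hS x)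

theorem IsSolution.integratedLoss_le_of_lipschitz [IsProbabilityMeasure μ] (hlam : 0 < lam)
    (hΛ : lam ≤ Λ)
    (hD : ∀ s ∈ Set.Icc τ.lo τ.hi, ∀ t ∈ Set.Icc τ.lo τ.hi,
      kΘ s s + kΘ t t - 2 * kΘ s t ≤ D ^ 2 * (s - t) ^ 2) (hm : 2 ≤ m)
    (hS : ∀ i, (S i).2 ∈ τ.outputs B) (hh : IsSolution τ μ lam m S h) (x : 𝒳) {y : ℝ}
    (hy : y ∈ τ.outputs B) :
    integratedLoss τ μ y (h x) ≤
      sampledLoss τ μ m y (h x) + quadratureConst κX κΘ B D Λ * (Real.log m / (√lam * m)) := by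
  have hlip (s t : τ.Hyper) : |h x s - h x t| ≤
      |D| * (|κX| * (√(2 * (|B| + 1)) / √lam)) * |(s : ℝ) - t| := by
    have hst : kΘ s s + kΘ t t - 2 * kΘ s t ≤ (|D| * |(s : ℝ) - t|) ^ 2 := by
      simpa only [mul_pow, sq_abs] using hD s s.2 t t.2
    refine (norm_apply_sub_apply_le (k := fun s t : τ.Hyper => kΘ s t) hΘ (by positivity) hst
      (h x)).trans ?_
    rw [mul_right_comm]
    gcongr
    exact hh.norm_apply_le hX hκX hlam hS x
  refine (InfiniteTask.integratedLoss_le_of_lipschitz μ hm hy (by positivity)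
    (hh.abs_apply_apply_le hX hκX hΘ hκΘ hlam hS x) hlip).trans ?_
  refine (add_le_add_iff_left _).2 (mul_log_div_le_of_le_quadratureConst hlam ?_)
  have : 0 < √lam := Real.sqrt_pos.2 hlam
  calc _ = 12 * (|B| + 1) * √lam + 12 * √(2 * (|B| + 1)) * |κX| * (2 * |D| + |κΘ|) := by
        field_simp
        ring
    _ ≤ quadratureConst κX κΘ B D Λ := by
        unfold quadratureConst
        gcongr
        exact le_add_of_nonneg_right zero_le_four

theorem eventually_integratedLoss_uniform_le_of_isSolution
    (hk : ContDiffOn ℝ 1 (Function.uncurry kΘ) (Set.Icc τ.lo τ.hi ×ˢ Set.Icc τ.lo τ.hi))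
    (hlam : 0 < lam) (hΛ : lam ≤ Λ) (B D : ℝ) :
    ∀ᶠ m in Filter.atTop, ∀ (n : ℕ) (S : Fin n → 𝒳 × ℝ), (∀ i, (S i).2 ∈ τ.outputs B) →
      ∀ h : H, IsSolution τ τ.uniform lam m S h → ∀ x, ∀ y ∈ τ.outputs B,
        integratedLoss τ τ.uniform y (h x) ≤ sampledLoss τ τ.uniform m y (h x) +
          quadratureConst κX κΘ B D Λ * (Real.log m / (√lam * m)) := by
  set F := |κΘ| * (|κX| * (√(2 * (|B| + 1)) / √lam)) with hF
  have hconst : (3 * (|B| + 1 + F) + 4) * √lam ≤ quadratureConst κX κΘ B D Λ := by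
    have : 0 < √lam := Real.sqrt_pos.2 hlam
    calc (3 * (|B| + 1 + F) + 4) * √lam
        = (3 * (|B| + 1) + 4) * √lam + 3 * √(2 * (|B| + 1)) * |κX| * |κΘ| := by
          rw [hF]
          field_simp
          ring
      _ ≤ quadratureConst κX κΘ B D Λ := by
          unfold quadratureConst
          gcongr
          · norm_num
          · norm_num
          · exact le_add_of_nonneg_left (by positivity)
  filter_upwards [eventually_integratedLoss_uniform_le hΘ hk B (A := κX ^ 2 / lam) (F := F)
    (by positivity) (by positivity)] with m hm n S hS h hh x y hy
  exact (hm (h x) (hh.abs_apply_apply_le hX hκX hΘ hκΘ hlam hS x)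
    (hh.isSupDominated hX hκX hlam hS x) y hy).trans
    ((add_le_add_iff_left _).2 (mul_log_div_le_of_le_quadratureConst hlam hconst))

end Solution

end InfiniteTask

end

open MeasureTheory InfiniteTask in
theorem mainTheorem1 (τ : Task) (κX κΘ B D Λ : ℝ) :
    ∃ (C₁ : ℝ → ℝ) (C₂ : ℝ),
      ∀ (𝒳 : Type*) [MeasurableSpace 𝒳] (P : Measure (𝒳 × ℝ)) [IsProbabilityMeasure P]
        (kX : 𝒳 → 𝒳 → ℝ) (kΘ : ℝ → ℝ → ℝ)
        (HΘ : Type*) [NormedAddCommGroup HΘ] [InnerProductSpace ℝ HΘ] [CompleteSpace HΘ]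
        [RKHS ℝ HΘ τ.Hyper ℝ]
        (H : Type*) [NormedAddCommGroup H] [InnerProductSpace ℝ H] [CompleteSpace H]
        [RKHS ℝ H 𝒳 HΘ],
        -- `HΘ` is the RKHS of `kΘ`, and `H` the vector-valued RKHS of `kX · I`
        (∀ s t : τ.Hyper, RKHS.kernel HΘ s t = kΘ s t • ContinuousLinearMap.id ℝ ℝ) →
        (∀ x z : 𝒳, RKHS.kernel H x z = kX x z • ContinuousLinearMap.id ℝ HΘ) →
        -- bounded kernels, bounded output, measurable `kX`, and `kΘ` of class `C¹`
        Measurable (Function.uncurry kX) →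
        (∀ x, kX x x ≤ κX ^ 2) →
        (∀ θ ∈ Set.Icc τ.lo τ.hi, kΘ θ θ ≤ κΘ ^ 2) →
        ContDiffOn ℝ 1 (Function.uncurry kΘ) (Set.Icc τ.lo τ.hi ×ˢ Set.Icc τ.lo τ.hi) →
        (∀ᵐ z ∂P, z.2 ∈ τ.outputs B) →
        -- the regularized problem has exactly one solution
        (∀ (μ : Measure τ.Hyper) [IsProbabilityMeasure μ] (lam : ℝ), 0 < lam →
          ∀ (m n : ℕ) (S : Fin n → 𝒳 × ℝ), ∃! h : H, IsSolution τ μ lam m S h) ∧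
        -- the bound for uniform `μ`, as `n, m → ∞`, with constants that do not depend on `lam`
        (∀ lam : ℝ, 0 < lam → lam ≤ Λ → ∃ M : ℕ, ∀ m ≥ M, ∀ n ≥ 1, ∀ δ : ℝ, 0 < δ →
          Measure.pi (fun _ : Fin n => P)
            {S | ∃ h : H, IsSolution τ τ.uniform lam m S h ∧
              ¬ (risk τ τ.uniform P h ≤ sampledEmpiricalRisk τ τ.uniform m S h
                + C₁ δ / √(lam * n) + C₂ * (Real.log m / (√lam * m)))}
            ≤ ENNReal.ofReal δ) ∧
        -- the bound for any `μ` and uniformly in `lam`, if `θ ↦ kΘ(θ, ·)` is Lipschitz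
        ((∀ s ∈ Set.Icc τ.lo τ.hi, ∀ t ∈ Set.Icc τ.lo τ.hi,
            kΘ s s + kΘ t t - 2 * kΘ s t ≤ D ^ 2 * (s - t) ^ 2) →
          ∀ (μ : Measure τ.Hyper) [IsProbabilityMeasure μ] (lam : ℝ), 0 < lam → lam ≤ Λ →
          ∀ m ≥ 2, ∀ n ≥ 1, ∀ δ : ℝ, 0 < δ →
            Measure.pi (fun _ : Fin n => P)
              {S | ∃ h : H, IsSolution τ μ lam m S h ∧
                ¬ (risk τ μ P h ≤ sampledEmpiricalRisk τ μ m S h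
                  + C₁ δ / √(lam * n) + C₂ * (Real.log m / (√lam * m)))}
              ≤ ENNReal.ofReal δ) := by
  refine ⟨deviationConst (|κX| * |κΘ|) B Λ, quadratureConst κX κΘ B D Λ, ?_⟩
  intro 𝒳 _ P _ kX kΘ HΘ _ _ _ _ H _ _ _ _ hΘ hX hXm hκX hκΘ hk hP
  have hmeas (θ : τ.Hyper) := measurable_inner_pointFeature (HΘ := HΘ) (H := H) hX hXm θ
  have hnorm (x : 𝒳) (θ : τ.Hyper) : ‖pointFeature H x θ‖ ≤ |κX| * |κΘ| :=
    norm_pointFeature_le (kΘ := fun s t : τ.Hyper => kΘ s t) hΘ hX hκX (fun θ => hκΘ θ θ.2) x θ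
  have hκ0 : 0 ≤ |κX| * |κΘ| := by positivity
  refine ⟨fun μ _ lam hlam m n S => existsUnique_isSolution μ m S hlam,
    fun lam hlam hΛ => ?_, fun hD μ _ lam hlam hΛ m hm n hn δ hδ => ?_⟩
  · obtain ⟨M, hM⟩ := Filter.eventually_atTop.1
      (eventually_integratedLoss_uniform_le_of_isSolution hX hκX hΘ hκΘ hk hlam hΛ B D)
    exact ⟨M, fun m hm n hn δ hδ => measure_isSolution_risk_gt_le hmeas hκ0 hnorm hP hlam hΛ hδ
      (Nat.one_le_iff_ne_zero.1 hn) (hM m hm n)⟩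
  · exact measure_isSolution_risk_gt_le hmeas hκ0 hnorm hP hlam hΛ hδ
      (Nat.one_le_iff_ne_zero.1 hn) fun S hS h hh x y hy =>
        hh.integratedLoss_le_of_lipschitz hX hκX hΘ hκΘ hlam hΛ hD hm hS x hy
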